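/- Let $G=\mathbf Z/2$. For a compact Hausdorff space $X$ with an action of $G$, generated by an involution $x\mapsto\bar x$, a Real bundle on $X$ (in the sense of Atiyah) is a complex vector bundle $E$ on $X$ with a continuous involution $v\mapsto\bar v$ of its total space that covers the involution of $X$ and is conjugate-linear on the fibres; $KR(X)$ is the Grothendieck group of the additive category of Real bundles on $X$. Suppose that $G$ acts freely on the compact Hausdorff space $X$, and let $Y=X/G$. Let $L=X\times_G\mathbf R$ be the real line bundle on $Y$ associated to the double covering $X\to Y$ (so that $[\bar x,t]=[x,-t]$), with the metric $[x,t]\mapsto t^2$. Let $C^-(L)$ be the bundle on $Y$ of the Clifford algebras of the fibres of $L$ with the quadratic form $[x,t]\mapsto -t^2$; it is an algebra bundle. Let $K^{C^-(L)}(Y)$ be the twisted $K$-theory of $Y$ associated to $C^-(L)$, i.e. the Grothendieck group of the additive category of real vector bundles $F$ on $Y$ with a continuous (unital) action $C^-(L)\times_Y F\to F$ of the algebra bundle $C^-(L)$. Vector bundles are locally trivial of finite rank, and the rank may vary from one component to another. An equivariant continuous map $f:X'\to X$ between two such spaces induces a map $\bar f:Y'\to Y$, a morphism $C^-(L')\to\bar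 f^*C^-(L)$ determined by $[x',t]\mapsto[f(x'),t]$, and hence pullback homomorphisms $f^*:KR(X)\to KR(X')$ and $\bar f^*:K^{C^-(L)}(Y)\to K^{C^-(L')}(Y')$. **Theorem.** There are isomorphisms of groups $$\Phi_X: KR(X)\;\xrightarrow{\ \cong\ }\;K^{C^-(L)}(Y),$$ one for every compact Hausdorff space $X$ with a free action of $G$, such that: 1. they are natural in $X$: $\Phi_{X'}\circ f^*=\bar f^*\circ\Phi_X$ for every equivariant continuous map $f:X'\to X$; 2. $\Phi_X$ is induced by $E\mapsto E/G$: for every Real bundle $E$ on $X$ there is a $C^-(L)$-module bundle $F$ on $Y$ with a continuous map $q:E\to F$ of total spaces over $X\to Y$ that is an $\mathbf R$-linear isomorphism on each fibre and satisfies $q(\bar v)=q(v)$ for all $v$ and $q(iv)=[x,1]\cdot q(v)$ for $v\in E_x$; and $\Phi_X([E])=[F]$ for every such $F$. -/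

import Mathlib

open Bundle Topology

universe u

namespace RealKTheory

/-! ### Grothendieck groups -/

/-- The Grothendieck group of an additive category with objects `Obj`, where `IsSum E E₁ E₂` means
that `E` is a direct sum of `E₁` and `E₂`: the abelian group generated by the objects, with the
relations `[E] = [E₁] + [E₂]` for all direct sums. -/
def GrothendieckGroup (Obj : Type*) (IsSum : Obj → Obj → Obj → Prop) : Type _ :=
  FreeAbelianGroup Obj ⧸ AddSubgroup.closure
    {z | ∃ E E₁ E₂, IsSum E E₁ E₂ ∧
      z = FreeAbelianGroup.of E - (FreeAbelianGroup.of E₁ + FreeAbelianGroup.of E₂)}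

namespace GrothendieckGroup

variable {Obj Obj' : Type*} {IsSum : Obj → Obj → Obj → Prop} {IsSum' : Obj' → Obj' → Obj' → Prop}

noncomputable instance : AddCommGroup (GrothendieckGroup Obj IsSum) :=
  inferInstanceAs (AddCommGroup (FreeAbelianGroup Obj ⧸ AddSubgroup.closure _))

/-- The class `[E]` of an object. -/
def cls (IsSum : Obj → Obj → Obj → Prop) (E : Obj) : GrothendieckGroup Obj IsSum :=
  QuotientAddGroup.mk (FreeAbelianGroup.of E)

/-- An operation on objects that preserves direct sums induces a homomorphism `[E] ↦ [T E]`. -/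
noncomputable def map (T : Obj → Obj')
    (hT : ∀ E E₁ E₂, IsSum E E₁ E₂ → IsSum' (T E) (T E₁) (T E₂)) :
    GrothendieckGroup Obj IsSum →+ GrothendieckGroup Obj' IsSum' :=
  QuotientAddGroup.map _ _ (FreeAbelianGroup.map T) (by
    rw [AddSubgroup.closure_le]
    rintro _ ⟨E, E₁, E₂, h, rfl⟩
    apply AddSubgroup.subset_closure
    exact ⟨T E, T E₁, T E₂, hT _ _ _ h, by simp⟩)

end GrothendieckGroup

/-! ### Vector bundles -/

/-- A (topological, locally trivial, finite-dimensional) `𝕜`-vector bundle on `B`. The rank is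
locally constant, but may differ between components. -/
structure VBundle (𝕜 : Type) [RCLike 𝕜] (B : Type u) [TopologicalSpace B] : Type (u + 1) where
  Fiber : B → Type u
  [addCommGroup : ∀ b, AddCommGroup (Fiber b)]
  [module : ∀ b, Module 𝕜 (Fiber b)]
  [topTotal : TopologicalSpace (TotalSpace Unit Fiber)]
  continuous_proj : Continuous (fun p : TotalSpace Unit Fiber => p.proj)
  /-- over an open neighbourhood `U` of any point, the bundle is isomorphic to `U × 𝕜ⁿ` -/
  locally_trivial : ∀ b, ∃ (U : Set B) (n : ℕ) (φ : ∀ x : U, Fiber x ≃ₗ[𝕜] (Fin n → 𝕜)),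
    IsOpen U ∧ b ∈ U ∧
    Continuous (fun p : {p : TotalSpace Unit Fiber // p.proj ∈ U} =>
      φ ⟨p.1.proj, p.2⟩ p.1.snd) ∧
    Continuous (fun p : U × (Fin n → 𝕜) =>
      (⟨p.1, (φ p.1).symm p.2⟩ : TotalSpace Unit Fiber))

attribute [instance] VBundle.addCommGroup VBundle.module VBundle.topTotal

/-- The total space of a vector bundle. -/
abbrev VBundle.Total {𝕜 : Type} [RCLike 𝕜] {B : Type u} [TopologicalSpace B]
    (E : VBundle 𝕜 B) : Type u :=
  TotalSpace Unit E.Fiber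

/-- A morphism of vector bundles over the identity of `B`. -/
structure VBundle.Hom {𝕜 : Type} [RCLike 𝕜] {B : Type u} [TopologicalSpace B]
    (E F : VBundle 𝕜 B) where
  app : ∀ b, E.Fiber b →ₗ[𝕜] F.Fiber b
  continuous_app : Continuous (fun p : E.Total => (⟨p.proj, app p.proj p.snd⟩ : F.Total))

/-- The total space of the pullback along `f` of a family of spaces over `B` carries the topology of
the fibre product of `B'` with the total space of the family. -/
@[reducible]
def pullbackTopology {B' B : Type u} [TopologicalSpace B'] (f : B' → B) (Fib : B → Type u) [TopologicalSpace (TotalSpace Unit Fib)] :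
    TopologicalSpace (TotalSpace Unit (fun b' => Fib (f b'))) :=
  TopologicalSpace.induced
    (fun p => (p.proj, (⟨f p.proj, p.snd⟩ : TotalSpace Unit Fib))) inferInstance

theorem continuous_pullback_iff {B' B : Type u} [TopologicalSpace B'] (f : B' → B) (Fib : B → Type u)
    [TopologicalSpace (TotalSpace Unit Fib)] {Z : Type*} [TopologicalSpace Z]
    (g : Z → TotalSpace Unit (fun b' => Fib (f b'))) :
    Continuous[_, pullbackTopology f Fib] g ↔
      Continuous (fun z => (g z).proj) ∧
      Continuous (fun z => (⟨f (g z).proj, (g z).snd⟩ : TotalSpace Unit Fib)) := by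
  rw [pullbackTopology, continuous_induced_rng, continuous_prodMk.symm]
  rfl

theorem pullback_continuous {B' B : Type u} [TopologicalSpace B'] (f : B' → B) (Fib : B → Type u)
    [TopologicalSpace (TotalSpace Unit Fib)] :
    Continuous[pullbackTopology f Fib, _]
      (fun p : TotalSpace Unit (fun b' => Fib (f b')) => p.proj) ∧
    Continuous[pullbackTopology f Fib, _]
      (fun p : TotalSpace Unit (fun b' => Fib (f b')) =>
        (⟨f p.proj, p.snd⟩ : TotalSpace Unit Fib)) := by
  let := pullbackTopology f Fib
  exact (continuous_pullback_iff f Fib id).1 continuous_id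

theorem pullback_ext {B' B : Type u} (f : B' → B) (Fib : B → Type u)
    {p q : TotalSpace Unit (fun b' => Fib (f b'))} (h : p.proj = q.proj)
    (h' : (⟨f p.proj, p.snd⟩ : TotalSpace Unit Fib) = ⟨f q.proj, q.snd⟩) : p = q := by
  obtain ⟨b, v⟩ := p
  obtain ⟨c, w⟩ := q
  obtain rfl : b = c := h
  simpa using h'

section Pullback

variable {B' B : Type u} [TopologicalSpace B'] [TopologicalSpace B]

/-- The pullback of a vector bundle along a continuous map. -/
def VBundle.pullback {𝕜 : Type} [RCLike 𝕜] (f : C(B', B)) (E : VBundle 𝕜 B) : VBundle 𝕜 B' :=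
  letI := pullbackTopology f E.Fiber
  { Fiber := fun b' => E.Fiber (f b')
    continuous_proj := (pullback_continuous f E.Fiber).1
    locally_trivial := fun b' => by
      obtain ⟨U, n, φ, hU, hb, h1, h2⟩ := E.locally_trivial (f b')
      refine ⟨f ⁻¹' U, n, fun x => φ ⟨f x, x.2⟩, hU.preimage f.continuous, hb, ?_, ?_⟩
      · exact h1.comp (f := fun p : {p : TotalSpace Unit (fun b' => E.Fiber (f b')) //
            p.proj ∈ f ⁻¹' U} => (⟨⟨f p.1.proj, p.1.snd⟩, p.2⟩ : {p : E.Total // p.proj ∈ U}))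
          (((pullback_continuous f E.Fiber).2.comp continuous_subtype_val).subtype_mk _)
      · rw [continuous_pullback_iff]
        refine ⟨continuous_subtype_val.comp continuous_fst, ?_⟩
        exact h2.comp (f := fun p : (f ⁻¹' U) × (Fin n → 𝕜) =>
            ((⟨f p.1, p.1.2⟩ : U), p.2))
          (((f.continuous.comp (continuous_subtype_val.comp continuous_fst)).subtype_mk _).prodMk
            continuous_snd) }

theorem VBundle.continuous_pullbackMap {𝕜 : Type} [RCLike 𝕜] (f : C(B', B)) (E : VBundle 𝕜 B) :
    Continuous (fun p : (E.pullback f).Total => (⟨f p.proj, p.snd⟩ : E.Total)) :=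
  (pullback_continuous f E.Fiber).2

/-- The pullback of a morphism of vector bundles. -/
def VBundle.Hom.pullback {𝕜 : Type} [RCLike 𝕜] (f : C(B', B)) {E F : VBundle 𝕜 B}
    (g : E.Hom F) : (E.pullback f).Hom (F.pullback f) where
  app b' := g.app (f b')
  continuous_app := (continuous_pullback_iff f F.Fiber _).2
    ⟨(E.pullback f).continuous_proj, g.continuous_app.comp (E.continuous_pullbackMap f)⟩

end Pullback

/-! ### Spaces with involution and Atiyah's `KR` -/

/-- A compact Hausdorff space with an action of `ℤ/2`, given by the involution `inv` through which
the generator acts (a compact "real space" in the sense of Atiyah). -/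
structure RealSpace : Type (u + 1) where
  carrier : Type u
  [top : TopologicalSpace carrier]
  [compact : CompactSpace carrier]
  [t2 : T2Space carrier]
  inv : carrier → carrier
  continuous_inv : Continuous inv
  inv_inv : ∀ x, inv (inv x) = x

attribute [instance] RealSpace.top RealSpace.compact RealSpace.t2

/-- A continuous equivariant map. -/
structure RealSpace.Hom (X' X : RealSpace.{u}) where
  toMap : C(X'.carrier, X.carrier)
  map_inv : ∀ x, toMap (X'.inv x) = X.inv (toMap x)

/-- A Real vector bundle in the sense of Atiyah: a complex vector bundle `E` on `X` with an
involution of the total space that covers the involution of `X` and is conjugate-linear on the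
fibres. -/
structure RealBundle (X : RealSpace.{u}) extends VBundle ℂ X.carrier where
  conj : ∀ x, Fiber x →ₛₗ[starRingEnd ℂ] Fiber (X.inv x)
  continuous_conj : Continuous (fun p : TotalSpace Unit Fiber =>
    (⟨X.inv p.proj, conj p.proj p.snd⟩ : TotalSpace Unit Fiber))
  conj_conj : ∀ p : TotalSpace Unit Fiber,
    (⟨X.inv (X.inv p.proj), conj _ (conj p.proj p.snd)⟩ : TotalSpace Unit Fiber) = p

/-- A morphism of Real vector bundles. -/
structure RealBundle.Hom {X : RealSpace.{u}} (E F : RealBundle X) extends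
    E.toVBundle.Hom F.toVBundle where
  map_conj : ∀ x (v : E.Fiber x), app (X.inv x) (E.conj x v) = F.conj x (app x v)

/-- `E` is a direct sum (biproduct) of the Real bundles `E₁` and `E₂`. -/
def RealBundle.IsSum {X : RealSpace.{u}} (E E₁ E₂ : RealBundle X) : Prop :=
  ∃ (i₁ : E₁.Hom E) (i₂ : E₂.Hom E) (p₁ : E.Hom E₁) (p₂ : E.Hom E₂),
    (∀ x v, p₁.app x (i₁.app x v) = v) ∧ (∀ x v, p₂.app x (i₂.app x v) = v) ∧
    ∀ x v, i₁.app x (p₁.app x v) + i₂.app x (p₂.app x v) = v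

/-- Atiyah's group `KR(X)`: the Grothendieck group of Real vector bundles on `X`. -/
abbrev KR (X : RealSpace.{u}) : Type (u + 1) :=
  GrothendieckGroup (RealBundle X) RealBundle.IsSum

/-- Transport between the fibres of a vector bundle over equal points. -/
def VBundle.fiberCast {𝕜 : Type} [RCLike 𝕜] {B : Type u} [TopologicalSpace B] (E : VBundle 𝕜 B)
    {b c : B} (h : b = c) : E.Fiber b ≃ₗ[𝕜] E.Fiber c :=
  h ▸ LinearEquiv.refl 𝕜 (E.Fiber b)

theorem VBundle.mk_fiberCast {𝕜 : Type} [RCLike 𝕜] {B : Type u} [TopologicalSpace B]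
    (E : VBundle 𝕜 B) {b c : B} (h : b = c) (v : E.Fiber b) :
    (⟨c, E.fiberCast h v⟩ : E.Total) = ⟨b, v⟩ := by
  subst h; rfl

theorem VBundle.hom_fiberCast {𝕜 : Type} [RCLike 𝕜] {B : Type u} [TopologicalSpace B]
    {E F : VBundle 𝕜 B} (g : ∀ b, E.Fiber b →ₗ[𝕜] F.Fiber b) {b c : B} (h : b = c)
    (v : E.Fiber b) : g c (E.fiberCast h v) = F.fiberCast h (g b v) := by
  subst h; rfl

/-- The pullback of a Real bundle along an equivariant map. -/
noncomputable def RealBundle.pullback {X' X : RealSpace.{u}} (f : X'.Hom X) (E : RealBundle X) :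
    RealBundle X' where
  toVBundle := E.toVBundle.pullback f.toMap
  conj x := (E.fiberCast (f.map_inv x).symm).toLinearMap.comp (E.conj (f.toMap x))
  continuous_conj := by
    refine (continuous_pullback_iff f.toMap E.Fiber _).2
      ⟨X'.continuous_inv.comp (E.toVBundle.pullback f.toMap).continuous_proj, ?_⟩
    refine Continuous.congr (f := fun p : (E.toVBundle.pullback f.toMap).Total =>
        (⟨X.inv (f.toMap p.proj), E.conj (f.toMap p.proj) p.snd⟩ : E.Total))
      (E.continuous_conj.comp (f := fun p : (E.toVBundle.pullback f.toMap).Total =>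
        (⟨f.toMap p.proj, p.snd⟩ : E.Total))
        (E.continuous_pullbackMap f.toMap)) fun p => ?_
    exact (E.mk_fiberCast (f.map_inv p.proj).symm _).symm
  conj_conj := by
    rintro ⟨x, v⟩
    refine pullback_ext f.toMap E.Fiber (X'.inv_inv x) ?_
    refine (E.mk_fiberCast (f.map_inv _).symm _).trans ?_
    refine Eq.trans ?_ (E.conj_conj ⟨f.toMap x, v⟩)
    exact congrArg (fun p : E.Total => (⟨X.inv p.proj, E.conj p.proj p.snd⟩ : E.Total))
      (E.mk_fiberCast (f.map_inv x).symm _)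

/-- The pullback of a morphism of Real bundles. -/
noncomputable def RealBundle.Hom.pullback {X' X : RealSpace.{u}} (f : X'.Hom X)
    {E F : RealBundle X} (g : E.Hom F) : (E.pullback f).Hom (F.pullback f) where
  toHom := g.toHom.pullback f.toMap
  map_conj x v :=
    (VBundle.hom_fiberCast g.app (f.map_inv x).symm _).trans
      (congrArg _ (g.map_conj (f.toMap x) v))

/-- The homomorphism `f^* : KR(X) → KR(X')` induced by an equivariant map `f : X' → X`. -/
noncomputable def KR.pullback {X' X : RealSpace.{u}} (f : X'.Hom X) : KR X →+ KR X' :=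
  GrothendieckGroup.map (RealBundle.pullback f) (by
    rintro E E₁ E₂ ⟨i₁, i₂, p₁, p₂, h₁, h₂, h⟩
    exact ⟨i₁.pullback f, i₂.pullback f, p₁.pullback f, p₂.pullback f,
      fun x v => h₁ (f.toMap x) v, fun x v => h₂ (f.toMap x) v, fun x v => h (f.toMap x) v⟩)

/-! ### Algebra bundles and twisted `K`-theory -/

/-- A (locally trivial, finite-dimensional, real) algebra bundle on `B`. -/
structure AlgebraBundle (B : Type u) [TopologicalSpace B] : Type (u + 1) where
  Fiber : B → Type u
  [ring : ∀ b, Ring (Fiber b)]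
  [algebra : ∀ b, Algebra ℝ (Fiber b)]
  [topTotal : TopologicalSpace (TotalSpace Unit Fiber)]
  continuous_proj : Continuous (fun p : TotalSpace Unit Fiber => p.proj)
  /-- over an open neighbourhood `U` of any point, the bundle is isomorphic to `U × A` for a
  finite-dimensional algebra `A` with its canonical topology -/
  locally_trivial : ∀ b, ∃ (U : Set B) (A : Type) (_ : Ring A) (_ : Algebra ℝ A)
      (_ : Module.Finite ℝ A) (_ : TopologicalSpace A) (_ : IsModuleTopology ℝ A)
      (φ : ∀ x : U, Fiber x ≃ₐ[ℝ] A),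
    IsOpen U ∧ b ∈ U ∧
    Continuous (fun p : {p : TotalSpace Unit Fiber // p.proj ∈ U} =>
      φ ⟨p.1.proj, p.2⟩ p.1.snd) ∧
    Continuous (fun p : U × A => (⟨p.1, (φ p.1).symm p.2⟩ : TotalSpace Unit Fiber))

attribute [instance] AlgebraBundle.ring AlgebraBundle.algebra AlgebraBundle.topTotal

/-- The total space of an algebra bundle. -/
abbrev AlgebraBundle.Total {B : Type u} [TopologicalSpace B] (A : AlgebraBundle B) : Type u :=
  TotalSpace Unit A.Fiber

/-- A vector bundle that is a module over the algebra bundle `A`: a real vector bundle `F` with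
a (unital) action of the algebra `A_b` on `F_b` for every `b`, such that the action map from the
fibre product of `A` and `F` to `F` is continuous. -/
structure ModuleBundle {B : Type u} [TopologicalSpace B] (A : AlgebraBundle B) extends
    VBundle ℝ B where
  action : ∀ b, A.Fiber b →ₐ[ℝ] Module.End ℝ (Fiber b)
  continuous_action : Continuous (fun p : TotalSpace (Unit × Unit) (A.Fiber ×ᵇ Fiber) =>
    (⟨p.proj, action p.proj p.snd.1 p.snd.2⟩ : TotalSpace Unit Fiber))

/-- A morphism of module bundles: a morphism of real vector bundles that commutes with the action
of the algebra bundle. -/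
structure ModuleBundle.Hom {B : Type u} [TopologicalSpace B] {A : AlgebraBundle B}
    (E F : ModuleBundle A) extends E.toVBundle.Hom F.toVBundle where
  map_action : ∀ b (a : A.Fiber b) (v : E.Fiber b),
    app b (E.action b a v) = F.action b a (app b v)

/-- `E` is a direct sum (biproduct) of the module bundles `E₁` and `E₂`. -/
def ModuleBundle.IsSum {B : Type u} [TopologicalSpace B] {A : AlgebraBundle B}
    (E E₁ E₂ : ModuleBundle A) : Prop :=
  ∃ (i₁ : E₁.Hom E) (i₂ : E₂.Hom E) (p₁ : E.Hom E₁) (p₂ : E.Hom E₂),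
    (∀ b v, p₁.app b (i₁.app b v) = v) ∧ (∀ b v, p₂.app b (i₂.app b v) = v) ∧
    ∀ b v, i₁.app b (p₁.app b v) + i₂.app b (p₂.app b v) = v

/-- The twisted `K`-theory of `B` associated to the algebra bundle `A`: the Grothendieck group of
the category of vector bundles on `B` that are modules over `A`. -/
abbrev TwistedK {B : Type u} [TopologicalSpace B] (A : AlgebraBundle B) : Type (u + 1) :=
  GrothendieckGroup (ModuleBundle A) ModuleBundle.IsSum

/-- A morphism of algebra bundles `A' → f^* A` on `B'`, where `f : B' → B`. -/
structure AlgebraBundle.HomOver {B' B : Type u} [TopologicalSpace B'] [TopologicalSpace B]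
    (f : C(B', B)) (A' : AlgebraBundle B') (A : AlgebraBundle B) where
  app : ∀ b', A'.Fiber b' →ₐ[ℝ] A.Fiber (f b')
  continuous_app : Continuous (fun p : A'.Total => (⟨f p.proj, app p.proj p.snd⟩ : A.Total))

section ModulePullback

variable {B' B : Type u} [TopologicalSpace B'] [TopologicalSpace B] {f : C(B', B)}
  {A' : AlgebraBundle B'} {A : AlgebraBundle B}

/-- The pullback `f^* F` of an `A`-module bundle `F`, on which `A'` acts through `A' → f^* A`. -/
noncomputable def ModuleBundle.pullback (θ : A'.HomOver f A) (F : ModuleBundle A) : ModuleBundle A' where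
  toVBundle := F.toVBundle.pullback f
  action b' := (F.action (f b')).comp (θ.app b')
  continuous_action := by
    have h := (FiberBundle.Prod.isInducing_diag Unit A'.Fiber Unit
      (F.toVBundle.pullback f).Fiber).continuous
    refine (continuous_pullback_iff f F.Fiber _).2 ⟨A'.continuous_proj.comp h.fst, ?_⟩
    refine F.continuous_action.comp
      (f := fun p : TotalSpace (Unit × Unit) (A'.Fiber ×ᵇ (F.toVBundle.pullback f).Fiber) =>
        (⟨f p.proj, θ.app p.proj p.snd.1, p.snd.2⟩ :
          TotalSpace (Unit × Unit) (A.Fiber ×ᵇ F.Fiber))) ?_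
    rw [(FiberBundle.Prod.isInducing_diag Unit A.Fiber Unit F.Fiber).continuous_iff]
    exact (θ.continuous_app.comp h.fst).prodMk
      ((F.toVBundle.continuous_pullbackMap f).comp h.snd)

/-- The pullback of a morphism of module bundles. -/
noncomputable def ModuleBundle.Hom.pullback (θ : A'.HomOver f A) {E F : ModuleBundle A} (g : E.Hom F) :
    (E.pullback θ).Hom (F.pullback θ) where
  toHom := g.toHom.pullback f
  map_action b' a v := g.map_action (f b') (θ.app b' a) v

/-- The homomorphism of twisted `K`-groups induced by `f : B' → B` and `A' → f^* A`. -/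
noncomputable def TwistedK.pullback (θ : A'.HomOver f A) : TwistedK A →+ TwistedK A' :=
  GrothendieckGroup.map (ModuleBundle.pullback θ) (by
    rintro E E₁ E₂ ⟨i₁, i₂, p₁, p₂, h₁, h₂, h⟩
    exact ⟨i₁.pullback θ, i₂.pullback θ, p₁.pullback θ, p₂.pullback θ,
      fun b v => h₁ (f b) v, fun b v => h₂ (f b) v, fun b v => h (f b) v⟩)

end ModulePullback

/-! ### Free involutions, the line bundle `L` and the Clifford bundle `C⁻(L)` -/

/-- A compact Hausdorff space with a free action of `ℤ/2`. -/
structure FreeRealSpace : Type (u + 1) extends RealSpace.{u} where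
  inv_ne : ∀ x, inv x ≠ x

namespace FreeRealSpace

variable (X : FreeRealSpace.{u})

/-- The orbit relation of the action. -/
def orbitSetoid : Setoid X.carrier where
  r x y := y = x ∨ y = X.inv x
  iseqv :=
    { refl := fun x => Or.inl rfl
      symm := by
        rintro x y (rfl | rfl)
        · exact Or.inl rfl
        · exact Or.inr (X.inv_inv x).symm
      trans := by
        rintro x y z (rfl | rfl) (rfl | rfl)
        · exact Or.inl rfl
        · exact Or.inr rfl
        · exact Or.inr rfl
        · exact Or.inl (X.inv_inv x) }

/-- The quotient space `Y = X / (ℤ/2)`. -/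
def Quot : Type u := Quotient X.orbitSetoid

instance : TopologicalSpace X.Quot := inferInstanceAs (TopologicalSpace (Quotient X.orbitSetoid))

/-- The quotient map `X → Y`. -/
def proj : C(X.carrier, X.Quot) where
  toFun x := Quotient.mk X.orbitSetoid x
  continuous_toFun := continuous_quotient_mk'

theorem proj_eq {x y : X.carrier} : X.proj x = X.proj y ↔ y = x ∨ y = X.inv x :=
  Quotient.eq (r := X.orbitSetoid)

theorem proj_inv (x : X.carrier) : X.proj (X.inv x) = X.proj x :=
  X.proj_eq.2 (Or.inr (X.inv_inv x).symm)

theorem proj_surjective : Function.Surjective X.proj := Quotient.mk_surjective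

theorem isOpenMap_proj : IsOpenMap X.proj := by
  intro U hU
  have h : X.proj ⁻¹' (X.proj '' U) = U ∪ X.inv ⁻¹' U := by
    ext x
    constructor
    · rintro ⟨z, hz, h⟩
      rcases X.proj_eq.1 h.symm with rfl | rfl
      · exact Or.inl hz
      · exact Or.inr hz
    · rintro (h | h)
      · exact ⟨x, h, rfl⟩
      · exact ⟨X.inv x, h, X.proj_inv x⟩
  have hq : IsQuotientMap X.proj := isQuotientMap_quotient_mk'
  rw [← hq.isOpen_preimage, h]
  exact hU.union (hU.preimage X.continuous_inv)

/-- The orbit over a point `y` of the quotient. -/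
abbrev Orbit (y : X.Quot) : Type u := {x : X.carrier // X.proj x = y}

/-- The involution on an orbit. -/
def flip {y : X.Quot} (x : X.Orbit y) : X.Orbit y := ⟨X.inv x, (X.proj_inv x).trans x.2⟩

variable {X}

theorem flip_flip {y : X.Quot} (x : X.Orbit y) : X.flip (X.flip x) = x :=
  Subtype.ext (X.inv_inv x)

theorem flip_ne {y : X.Quot} (x : X.Orbit y) : X.flip x ≠ x :=
  fun h => X.inv_ne x (congrArg Subtype.val h)

theorem orbit_eq {y : X.Quot} (x z : X.Orbit y) : z = x ∨ z = X.flip x := by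
  rcases X.proj_eq.1 (x.2.trans z.2.symm) with h | h
  · exact Or.inl (Subtype.ext h)
  · exact Or.inr (Subtype.ext h)

variable (X)

/-- For a family `Fib` over `Y` and identifications `θ y x : V ≃ Fib y` for the points `x` of the
orbit `y`, the topology on the total space of `Fib` as a quotient of `X × V` through
`(x, v) ↦ θ [x] x v`. -/
@[reducible]
def assocTopology {V : Type*} [TopologicalSpace V] (Fib : X.Quot → Type u)
    (θ : ∀ y, X.Orbit y → V ≃ Fib y) : TopologicalSpace (TotalSpace Unit Fib) :=
  TopologicalSpace.coinduced
    (fun p : X.carrier × V => ⟨X.proj p.1, θ (X.proj p.1) ⟨p.1, rfl⟩ p.2⟩) inferInstance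

theorem assoc_locally_trivial {V : Type*} [TopologicalSpace V] (ν : V → V) (hν : Continuous ν)
    (Fib : X.Quot → Type u) (θ : ∀ y, X.Orbit y → V ≃ Fib y)
    (hθ : ∀ y x v, θ y (X.flip x) v = θ y x (ν v)) :
    let := X.assocTopology Fib θ
    Continuous (fun p : TotalSpace Unit Fib => p.proj) ∧
    ∀ y, ∃ (U : Set X.Quot) (sec : ∀ u : U, X.Orbit u), IsOpen U ∧ y ∈ U ∧
      Continuous (fun p : {p : TotalSpace Unit Fib // p.proj ∈ U} =>
        (θ p.1.proj (sec ⟨p.1.proj, p.2⟩)).symm p.1.snd) ∧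
      Continuous (fun p : U × V => (⟨p.1, θ p.1 (sec p.1) p.2⟩ : TotalSpace Unit Fib)) := by
  intro _
  set q : X.carrier × V → TotalSpace Unit Fib :=
    fun p => ⟨X.proj p.1, θ (X.proj p.1) ⟨p.1, rfl⟩ p.2⟩ with hq
  have hqs : Function.Surjective q := by
    rintro ⟨y, w⟩
    obtain ⟨x, rfl⟩ := X.proj_surjective y
    exact ⟨(x, (θ _ ⟨x, rfl⟩).symm w), by simp [hq]⟩
  have hqq : IsQuotientMap q := ⟨⟨rfl⟩, hqs⟩
  have hproj : Continuous (fun p : TotalSpace Unit Fib => p.proj) :=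
    hqq.continuous_iff.2 (X.proj.continuous.comp continuous_fst)
  refine ⟨hproj, fun y => ?_⟩
  obtain ⟨x₀, rfl⟩ := X.proj_surjective y
  obtain ⟨S, T, hS, hT, hxS, hxT, hST⟩ := t2_separation (X.inv_ne x₀).symm
  set W : Set X.carrier := S ∩ X.inv ⁻¹' T with hW
  have hWo : IsOpen W := hS.inter (hT.preimage X.continuous_inv)
  have hWi : ∀ x ∈ W, X.inv x ∉ W := fun x hx hx' =>
    Set.disjoint_left.1 hST hx'.1 hx.2
  have hWu : ∀ x ∈ W, ∀ z ∈ W, X.proj x = X.proj z → x = z := by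
    intro x hx z hz h
    rcases X.proj_eq.1 h with rfl | rfl
    · rfl
    · exact absurd hz (hWi x hx)
  have hex : ∀ u : X.proj '' W, ∃ x ∈ W, X.proj x = u := fun u => u.2
  choose sec hsW hsec using hex
  have hcs : Continuous sec := by
    refine continuous_def.2 fun O hO => ?_
    have : sec ⁻¹' O = Subtype.val ⁻¹' (X.proj '' (W ∩ O)) := by
      ext u
      constructor
      · intro h
        exact ⟨sec u, ⟨hsW u, h⟩, hsec u⟩
      · rintro ⟨x, ⟨hxW, hxO⟩, hx⟩
        have : sec u = x := hWu _ (hsW u) _ hxW ((hsec u).trans hx.symm)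
        simpa [this] using hxO
    rw [this]
    exact (X.isOpenMap_proj _ (hWo.inter hO)).preimage continuous_subtype_val
  refine ⟨X.proj '' W, fun u => ⟨sec u, hsec u⟩, X.isOpenMap_proj _ hWo,
    ⟨x₀, ⟨hxS, hxT⟩, rfl⟩, ?_, ?_⟩
  · have hr := hqq.restrictPreimage_isOpen ((X.isOpenMap_proj _ hWo).preimage hproj)
    refine hr.continuous_iff.2 (continuous_iff_continuousAt.2 ?_)
    rintro ⟨⟨x, v⟩, hx⟩
    have key : ∀ z : q ⁻¹' ((fun p : TotalSpace Unit Fib => p.proj) ⁻¹' (X.proj '' W)),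
        (z.1.1 ∈ W → (θ (X.proj z.1.1) ⟨sec ⟨X.proj z.1.1, z.2⟩, hsec ⟨X.proj z.1.1, z.2⟩⟩).symm
          (θ (X.proj z.1.1) ⟨z.1.1, rfl⟩ z.1.2) = z.1.2) ∧
        (X.inv z.1.1 ∈ W → (θ (X.proj z.1.1) ⟨sec ⟨X.proj z.1.1, z.2⟩, hsec ⟨X.proj z.1.1, z.2⟩⟩).symm
          (θ (X.proj z.1.1) ⟨z.1.1, rfl⟩ z.1.2) = ν z.1.2) := by
      rintro ⟨⟨z, w⟩, hz⟩
      refine ⟨fun h => ?_, fun h => ?_⟩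
      · have e : (⟨sec ⟨X.proj z, hz⟩, hsec ⟨X.proj z, hz⟩⟩ : X.Orbit (X.proj z)) = ⟨z, rfl⟩ :=
          Subtype.ext (hWu _ (hsW _) _ h (hsec ⟨X.proj z, hz⟩))
        simp only [e, Equiv.symm_apply_apply]
      · have e : (⟨z, rfl⟩ : X.Orbit (X.proj z)) =
            X.flip ⟨sec ⟨X.proj z, hz⟩, hsec ⟨X.proj z, hz⟩⟩ := by
          apply Subtype.ext
          have : sec ⟨X.proj z, hz⟩ = X.inv z :=
            hWu _ (hsW _) _ h ((hsec ⟨X.proj z, hz⟩).trans (X.proj_inv z).symm)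
          simp [flip, this, X.inv_inv]
        simp only
        rw [e, hθ, Equiv.symm_apply_apply]
    have hcf : Continuous (fun z : q ⁻¹' ((fun p : TotalSpace Unit Fib => p.proj) ⁻¹'
        (X.proj '' W)) => z.1.1) := continuous_fst.comp continuous_subtype_val
    have hcv : Continuous (fun z : q ⁻¹' ((fun p : TotalSpace Unit Fib => p.proj) ⁻¹'
        (X.proj '' W)) => z.1.2) := continuous_snd.comp continuous_subtype_val
    have hcase : x ∈ W ∨ X.inv x ∈ W := by
      obtain ⟨z, hz, h⟩ := hx
      rcases X.proj_eq.1 h.symm with rfl | rfl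
      · exact Or.inl hz
      · exact Or.inr hz
    rcases hcase with h | h
    · refine hcv.continuousAt.congr ?_
      filter_upwards [(hWo.preimage hcf).mem_nhds h] with z hz
      exact ((key z).1 hz).symm
    · refine (hν.comp hcv).continuousAt.congr ?_
      filter_upwards [((hWo.preimage X.continuous_inv).preimage hcf).mem_nhds h] with z hz
      exact ((key z).2 hz).symm
  · have : (fun p : (X.proj '' W) × V =>
        (⟨p.1, θ p.1 ⟨sec p.1, hsec p.1⟩ p.2⟩ : TotalSpace Unit Fib)) =
        fun p => q (sec p.1, p.2) := by
      funext ⟨u, v⟩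
      have : ∀ (y : X.Quot) (x : X.carrier) (h : X.proj x = y),
          (⟨y, θ y ⟨x, h⟩ v⟩ : TotalSpace Unit Fib) = q (x, v) := by
        rintro _ x rfl
        rfl
      exact this _ _ _
    rw [this]
    exact hqq.continuous.comp ((hcs.comp continuous_fst).prodMk continuous_snd)

/-- The fibre of `L = X ×_{ℤ/2} ℝ` (where `ℤ/2` acts on `ℝ` by sign) over `y`: the functions
`s` on the orbit `y` with `s (-x) = - s x`. The class `[x, t]` is the function with value `t`
at `x`. -/
def lineFiber (y : X.Quot) : Submodule ℝ (X.Orbit y → ℝ) where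
  carrier := {s | ∀ x, s (X.flip x) = - s x}
  add_mem' := by
    intro s t hs ht x
    simp only [Pi.add_apply, hs x, ht x]
    ring
  zero_mem' := by
    intro x
    simp
  smul_mem' := by
    intro c s hs x
    simp [hs x]

open Classical in
/-- The isomorphism `ℝ ≃ L_y`, `t ↦ [x, t]`, given by a point `x` of the orbit `y`. -/
noncomputable def lineEquiv (y : X.Quot) (x : X.Orbit y) : ℝ ≃ₗ[ℝ] X.lineFiber y where
  toFun t := ⟨fun z => if z = x then t else -t, fun z => by
    rcases orbit_eq x z with rfl | rfl
    · simp [flip_ne]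
    · simp [flip_ne, flip_flip]⟩
  map_add' s t := by
    ext z
    by_cases h : z = x <;> simp [h]
    ring
  map_smul' c t := by
    ext z
    by_cases h : z = x <;> simp [h]
  invFun s := s.1 x
  left_inv t := by simp
  right_inv s := by
    ext z
    rcases orbit_eq x z with rfl | rfl
    · simp
    · simp [flip_ne, s.2 x]

theorem lineEquiv_flip (y : X.Quot) (x : X.Orbit y) (t : ℝ) :
    X.lineEquiv y (X.flip x) t = X.lineEquiv y x (-t) := by
  apply (X.lineEquiv y (X.flip x)).symm.injective
  rw [LinearEquiv.symm_apply_apply]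
  simp [lineEquiv, flip_ne]

/-- The real line bundle `L` on `Y` associated to the double covering `X → Y`. -/
noncomputable def lineBundle : VBundle ℝ X.Quot :=
  letI := X.assocTopology (fun y => X.lineFiber y) (fun y x => (X.lineEquiv y x).toEquiv)
  have h := X.assoc_locally_trivial (fun t : ℝ => -t) continuous_neg (fun y => X.lineFiber y)
    (fun y x => (X.lineEquiv y x).toEquiv) X.lineEquiv_flip
  { Fiber := fun y => X.lineFiber y
    continuous_proj := h.1
    locally_trivial := fun y => by
      obtain ⟨U, sec, hU, hy, h1, h2⟩ := h.2 y
      refine ⟨U, 1, fun u => (X.lineEquiv u (sec u)).symm.trans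
        (LinearEquiv.funUnique (Fin 1) ℝ ℝ).symm, hU, hy, ?_, ?_⟩
      · exact continuous_pi fun _ => h1
      · exact h2.comp (f := fun p : U × (Fin 1 → ℝ) => (p.1, p.2 0))
          (continuous_fst.prodMk ((continuous_apply 0).comp continuous_snd)) }

/-- The metric of `L`, as a quadratic form on the fibre over `y`: `[x, t] ↦ t²`. -/
noncomputable def lineMetric (y : X.Quot) : QuadraticForm ℝ (X.lineBundle.Fiber y) :=
  QuadraticMap.sq.comp
    (X.lineEquiv y ⟨Quotient.out y, Quotient.out_eq y⟩).symm.toLinearMap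

theorem lineMetric_lineEquiv (y : X.Quot) (x : X.Orbit y) (t : ℝ) :
    X.lineMetric y (X.lineEquiv y x t) = t * t := by
  have : ∀ z : X.Orbit y, QuadraticMap.sq (R := ℝ) ((X.lineEquiv y z).symm (X.lineEquiv y x t)) = t * t := by
    intro z
    rcases orbit_eq x z with rfl | rfl
    · simp
    · have : X.lineEquiv y x t = X.lineEquiv y (X.flip x) (-t) := by
        rw [lineEquiv_flip, neg_neg]
      rw [this]
      simp
  exact this _

/-- The isomorphism of Clifford algebras induced by `ℝ ≃ L_y`, `t ↦ [x, t]`, where `ℝ` has the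
quadratic form `t ↦ -t²` and `L_y` the opposite of its metric. -/
noncomputable def cliffordEquiv (y : X.Quot) (x : X.Orbit y) :
    CliffordAlgebra CliffordAlgebraComplex.Q ≃ₐ[ℝ] CliffordAlgebra (-(X.lineMetric y)) :=
  CliffordAlgebra.equivOfIsometry
    { X.lineEquiv y x with
      map_app' := fun t => congrArg Neg.neg (X.lineMetric_lineEquiv y x t) }

theorem cliffordEquiv_ι (y : X.Quot) (x : X.Orbit y) (t : ℝ) :
    X.cliffordEquiv y x (CliffordAlgebra.ι _ t) =
      CliffordAlgebra.ι (-(X.lineMetric y)) (X.lineEquiv y x t) :=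
  CliffordAlgebra.map_apply_ι _ t

theorem cliffordEquiv_flip (y : X.Quot) (x : X.Orbit y)
    (c : CliffordAlgebra CliffordAlgebraComplex.Q) :
    X.cliffordEquiv y (X.flip x) c = X.cliffordEquiv y x (CliffordAlgebra.involute c) := by
  have : (X.cliffordEquiv y (X.flip x)).toAlgHom =
      (X.cliffordEquiv y x).toAlgHom.comp CliffordAlgebra.involute := by
    refine CliffordAlgebra.hom_ext (LinearMap.ext fun t => ?_)
    change X.cliffordEquiv y (X.flip x) (CliffordAlgebra.ι _ t) =
      X.cliffordEquiv y x (CliffordAlgebra.involute (CliffordAlgebra.ι _ t))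
    rw [CliffordAlgebra.involute_ι, ← map_neg (CliffordAlgebra.ι _), cliffordEquiv_ι,
      cliffordEquiv_ι, lineEquiv_flip]
  exact DFunLike.congr_fun this c

/-- The canonical topology of the (finite-dimensional) Clifford algebra of `(ℝ, -t²)`. -/
noncomputable instance : TopologicalSpace (CliffordAlgebra CliffordAlgebraComplex.Q) :=
  moduleTopology ℝ _

instance : IsModuleTopology ℝ (CliffordAlgebra CliffordAlgebraComplex.Q) := ⟨rfl⟩

/-- The Clifford algebra bundle `C⁻(L)` on `Y`: its fibre over `y` is the Clifford algebra of `L_y`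
with the opposite of the metric, and its total space is topologized as the bundle
`X ×_{ℤ/2} Cl(ℝ, -t²)` associated to the double covering, where `ℤ/2` acts on `Cl(ℝ, -t²)` by the
automorphism induced by `t ↦ -t`. -/
noncomputable def cliffordBundle : AlgebraBundle X.Quot :=
  letI := X.assocTopology (fun y => CliffordAlgebra (-(X.lineMetric y)))
    (fun y x => (X.cliffordEquiv y x).toEquiv)
  have := IsModuleTopology.toContinuousAdd ℝ (CliffordAlgebra CliffordAlgebraComplex.Q)
  have h := X.assoc_locally_trivial
    (fun c : CliffordAlgebra CliffordAlgebraComplex.Q => CliffordAlgebra.involute c)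
    (IsModuleTopology.continuous_of_linearMap
      (CliffordAlgebra.involute (Q := CliffordAlgebraComplex.Q)).toLinearMap)
    (fun y => CliffordAlgebra (-(X.lineMetric y)))
    (fun y x => (X.cliffordEquiv y x).toEquiv) X.cliffordEquiv_flip
  { Fiber := fun y => CliffordAlgebra (-(X.lineMetric y))
    continuous_proj := h.1
    locally_trivial := fun y => by
      obtain ⟨U, sec, hU, hy, h1, h2⟩ := h.2 y
      exact ⟨U, CliffordAlgebra CliffordAlgebraComplex.Q, inferInstance, inferInstance,
        Module.Finite.equiv CliffordAlgebraComplex.equiv.symm.toLinearEquiv, inferInstance,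
        inferInstance, fun u => (X.cliffordEquiv u (sec u)).symm, hU, hy, h1, h2⟩ }

/-- The class `[x, t]` in the fibre of `L` over the image of `x`. -/
noncomputable def lineClass (x : X.carrier) (t : ℝ) : X.lineBundle.Fiber (X.proj x) :=
  X.lineEquiv (X.proj x) ⟨x, rfl⟩ t

/-- The inclusion `L_y → C⁻(L)_y`. -/
noncomputable def cliffordι (y : X.Quot) : X.lineBundle.Fiber y →ₗ[ℝ] X.cliffordBundle.Fiber y :=
  CliffordAlgebra.ι (-(X.lineMetric y))

/-! ### Functoriality in `X` -/

section Functoriality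

variable {X} {X' : FreeRealSpace.{u}} (f : X'.toRealSpace.Hom X.toRealSpace)

/-- The map of quotients `Y' → Y` induced by an equivariant map `f : X' → X`. -/
def quotMap : C(X'.Quot, X.Quot) where
  toFun := Quotient.map' (s₁ := X'.orbitSetoid) (s₂ := X.orbitSetoid) f.toMap (by
    rintro x y (rfl | rfl)
    · exact Or.inl rfl
    · exact Or.inr (f.map_inv x))
  continuous_toFun := Continuous.quotient_map' f.toMap.continuous _

/-- The map of orbits induced by `f`. -/
def orbitMap (y : X'.Quot) (x : X'.Orbit y) : X.Orbit (quotMap f y) :=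
  ⟨f.toMap x, congrArg (quotMap f) x.2⟩

theorem orbitMap_flip (y : X'.Quot) (x : X'.Orbit y) :
    orbitMap f y (X'.flip x) = X.flip (orbitMap f y x) :=
  Subtype.ext (f.map_inv x)

/-- The isomorphism `L'_y ≃ L_{f(y)}`, `[x, t] ↦ [f(x), t]`, defined by means of some point `x` of
the orbit `y` (the choice does not matter, by the next statement). -/
noncomputable def lineMap (y : X'.Quot) :
    X'.lineBundle.Fiber y ≃ₗ[ℝ] X.lineBundle.Fiber (quotMap f y) :=
  (X'.lineEquiv y ⟨Quotient.out y, Quotient.out_eq y⟩).symm.trans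
    (X.lineEquiv _ (orbitMap f y ⟨Quotient.out y, Quotient.out_eq y⟩))

theorem lineMap_lineEquiv (y : X'.Quot) (x : X'.Orbit y) (t : ℝ) :
    lineMap f y (X'.lineEquiv y x t) = X.lineEquiv _ (orbitMap f y x) t := by
  have : ∀ z : X'.Orbit y, X.lineEquiv _ (orbitMap f y z)
      ((X'.lineEquiv y z).symm (X'.lineEquiv y x t)) = X.lineEquiv _ (orbitMap f y x) t := by
    intro z
    rcases orbit_eq x z with rfl | rfl
    · simp
    · have : X'.lineEquiv y x t = X'.lineEquiv y (X'.flip x) (-t) := by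
        rw [lineEquiv_flip, neg_neg]
      rw [this, LinearEquiv.symm_apply_apply, orbitMap_flip, lineEquiv_flip, neg_neg]
  exact this _

theorem lineMetric_lineMap (y : X'.Quot) (s : X'.lineBundle.Fiber y) :
    X.lineMetric (quotMap f y) (lineMap f y s) = X'.lineMetric y s := by
  obtain ⟨t, rfl⟩ := (X'.lineEquiv y ⟨Quotient.out y, Quotient.out_eq y⟩).surjective s
  rw [lineMap_lineEquiv, lineMetric_lineEquiv, lineMetric_lineEquiv]

/-- The algebra homomorphism `C⁻(L')_y → C⁻(L)_{f(y)}` induced by `[x, t] ↦ [f(x), t]`. -/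
noncomputable def cliffordMapFiber (y : X'.Quot) :
    CliffordAlgebra (-(X'.lineMetric y)) →ₐ[ℝ] CliffordAlgebra (-(X.lineMetric (quotMap f y))) :=
  CliffordAlgebra.map
    { (lineMap f y).toLinearMap with
      map_app' := fun s => congrArg Neg.neg (lineMetric_lineMap f y s) }

theorem cliffordMapFiber_cliffordEquiv (y : X'.Quot) (x : X'.Orbit y)
    (c : CliffordAlgebra CliffordAlgebraComplex.Q) :
    cliffordMapFiber f y (X'.cliffordEquiv y x c) = X.cliffordEquiv _ (orbitMap f y x) c := by
  have : (cliffordMapFiber f y).comp (X'.cliffordEquiv y x).toAlgHom =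
      (X.cliffordEquiv _ (orbitMap f y x)).toAlgHom := by
    refine CliffordAlgebra.hom_ext (LinearMap.ext fun t => ?_)
    change cliffordMapFiber f y (X'.cliffordEquiv y x (CliffordAlgebra.ι _ t)) =
      X.cliffordEquiv _ (orbitMap f y x) (CliffordAlgebra.ι _ t)
    rw [cliffordEquiv_ι, cliffordEquiv_ι, ← lineMap_lineEquiv]
    exact CliffordAlgebra.map_apply_ι _ _
  exact DFunLike.congr_fun this c

/-- The morphism `C⁻(L') → f^* C⁻(L)` of algebra bundles induced by `[x, t] ↦ [f(x), t]`. -/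
noncomputable def cliffordMap :
    AlgebraBundle.HomOver (quotMap f) X'.cliffordBundle X.cliffordBundle where
  app y := cliffordMapFiber f y
  continuous_app := by
    refine continuous_coinduced_dom.2 ?_
    have h : Continuous[_, X.cliffordBundle.topTotal]
        (fun p : X.carrier × CliffordAlgebra CliffordAlgebraComplex.Q =>
          (⟨X.proj p.1, X.cliffordEquiv (X.proj p.1) ⟨p.1, rfl⟩ p.2⟩ : X.cliffordBundle.Total)) :=
      continuous_coinduced_rng
    refine Continuous.congr (h.comp (f := fun p : X'.carrier ×
      CliffordAlgebra CliffordAlgebraComplex.Q => (f.toMap p.1, p.2))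
      ((f.toMap.continuous.comp continuous_fst).prodMk continuous_snd)) fun p => ?_
    exact congrArg (fun c => (⟨X.proj (f.toMap p.1), c⟩ : X.cliffordBundle.Total))
      (cliffordMapFiber_cliffordEquiv f (X'.proj p.1) ⟨p.1, rfl⟩ p.2).symm

end Functoriality

end FreeRealSpace

/-- The relation `F = E / (ℤ/2)` between a Real bundle `E` on a free space `X` and a `C⁻(L)`-module
bundle `F` on `Y`: there is a continuous map `q : E → F` of total spaces over `X → Y` that is an
`ℝ`-linear isomorphism on the fibres, identifies `v` with `conj v`, and carries the complex
structure of `E` to the Clifford multiplication of `F`: for `v` in the fibre of `E` over `x`, one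
has `q (i v) = [x, 1] · q v`. -/
def IsCliffordQuotient {X : FreeRealSpace.{u}} (E : RealBundle X.toRealSpace)
    (F : ModuleBundle X.cliffordBundle) : Prop :=
  ∃ q : ∀ x, E.Fiber x →ₗ[ℝ] F.Fiber (X.proj x),
    Continuous (fun p : E.Total => (⟨X.proj p.proj, q p.proj p.snd⟩ : F.Total)) ∧
    (∀ x, Function.Bijective (q x)) ∧
    (∀ x v, (⟨X.proj (X.inv x), q (X.inv x) (E.conj x v)⟩ : F.Total) = ⟨X.proj x, q x v⟩) ∧
    ∀ x v, q x (Complex.I • v) =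
      F.action (X.proj x) (X.cliffordι (X.proj x) (X.lineClass x 1)) (q x v)

end RealKTheory

namespace RealKTheory

/-! ### Real vector bundles -/

/-! Over `X` the double covering becomes trivial, so the pullback of `C⁻(L)` to `X` is the trivial
bundle with fibre `Cl(ℝ, -t²) ≅ ℂ`, where `i` corresponds to `[x, 1]`. A `C⁻(L)`-module bundle `F`
on `Y` therefore pulls back to a complex bundle on `X`. The fibres over `x` and `inv x` are the same
real space `F_y`, but `[inv x, 1] = -[x, 1]`, so the two complex structures are conjugate and the
evident identification of these fibres is a Real structure. Conversely, a Real bundle `E` descends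
to `E/G`; multiplication by `i` depends on the point of the orbit only up to sign, and this sign is
exactly that of `L`. So Real bundles on `X` and `C⁻(L)`-modules on `Y` are equivalent, and the
equivalence identifies the Grothendieck groups.

The proof works with the relation `IsCliffordQuotient E F` instead of an equivalence of categories.
Morphisms descend along it (`exists_hom_of_hom`) and lift along it (`exists_hom_lift`), so it
preserves direct sums in both directions. It has enough pairs: `RealBundle.quotient` gives an `F`
for each `E`, and `ModuleBundle.lift` an `E` for each `F`. Comparing direct sums with a zero bundle
shows that each of `[E]` and `[F]` determines the other, which gives mutually inverse homomorphisms.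
Naturality holds because the relation is stable under pullback.

The topological work rests on one principle: the total space of `E` carries the topology of the
fibre product of `X` and `F` over `Y`. Continuity into `E` can thus be tested on the base point and
on the image in `F`. Together with `continuous_of_baseChange`, this reduces questions over `Y` to
questions over `X`. Local triviality of `E/G` comes from local sections of the covering; that of the
complex bundle over `F` comes from averaging a real trivialization over the complex structures
(`exists_local_complexFrame`). -/

/-- Inversion in a continuous family of linear isomorphisms is continuous. -/
theorem continuous_linearEquiv_symm_apply {Z : Type*} [TopologicalSpace Z] {V W : Type*}
    [NormedAddCommGroup V] [NormedSpace ℝ V] [FiniteDimensional ℝ V]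
    [NormedAddCommGroup W] [NormedSpace ℝ W] [FiniteDimensional ℝ W]
    (g : Z → V ≃ₗ[ℝ] W) (hg : Continuous fun p : Z × V => g p.1 p.2) :
    Continuous fun p : Z × W => (g p.1).symm p.2 := by
  have : CompleteSpace V := FiniteDimensional.complete ℝ V
  let G : Z → V ≃L[ℝ] W := fun z => (g z).toContinuousLinearEquiv
  have hG : Continuous fun z => (G z : V →L[ℝ] W) :=
    continuous_clm_apply.2 fun v => hg.comp (Continuous.prodMk_left v)
  have hG' : Continuous fun z => ((G z).symm : W →L[ℝ] V) := by
    refine continuous_iff_continuousAt.2 fun z => ?_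
    -- Inversion of operators is smooth at an invertible one; only the case `n = 0`, continuity, is
    -- needed.
    have h := ((contDiffAt_map_inverse (𝕜 := ℝ) (n := 0) (G z)).continuousAt).comp
      (f := fun z => (G z : V →L[ℝ] W)) hG.continuousAt
    refine h.congr (Filter.Eventually.of_forall fun z => ?_)
    simp
  exact (hG'.comp continuous_fst).clm_apply continuous_snd

/-- A map is continuous if it is continuous over the members of an open cover of the base. -/
theorem continuous_of_cover {Z B T : Type*} [TopologicalSpace Z] [TopologicalSpace B]
    [TopologicalSpace T] {ρ : Z → B} (hρ : Continuous ρ) {g : Z → T}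
    (h : ∀ b, ∃ U : Set B, IsOpen U ∧ b ∈ U ∧ Continuous fun z : {z // ρ z ∈ U} => g z) :
    Continuous g := by
  refine continuous_iff_continuousAt.2 fun z => ?_
  obtain ⟨U, hU, hz, hc⟩ := h (ρ z)
  have ho : IsOpen {z | ρ z ∈ U} := hU.preimage hρ
  exact (continuousOn_iff_continuous_domRestrict.2 hc).continuousAt (ho.mem_nhds hz)

namespace VBundle

variable {B : Type u} [TopologicalSpace B]

/-- The map of total spaces of a fibrewise bijective morphism of real vector bundles has a
continuous inverse. -/
theorem continuous_symm {E F : VBundle ℝ B} (g : ∀ b, E.Fiber b ≃ₗ[ℝ] F.Fiber b)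
    (hg : Continuous fun p : E.Total => (⟨p.proj, g p.proj p.snd⟩ : F.Total)) :
    Continuous fun p : F.Total => (⟨p.proj, (g p.proj).symm p.snd⟩ : E.Total) := by
  refine continuous_of_cover F.continuous_proj fun b => ?_
  obtain ⟨U, n, φ, hU, hbU, φ1, φ2⟩ := E.locally_trivial b
  obtain ⟨V, m, ψ, hV, hbV, ψ1, ψ2⟩ := F.locally_trivial b
  refine ⟨U ∩ V, hU.inter hV, ⟨hbU, hbV⟩, ?_⟩
  -- In local trivializations the morphism is a continuous family of invertible matrices, which can
  -- be inverted pointwise.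
  let γ : ↑(U ∩ V) → (Fin n → ℝ) ≃ₗ[ℝ] (Fin m → ℝ) := fun x =>
    ((φ ⟨x, x.2.1⟩).symm.trans (g x)).trans (ψ ⟨x, x.2.2⟩)
  have hγ : Continuous fun p : ↑(U ∩ V) × (Fin n → ℝ) => γ p.1 p.2 := by
    have h1 : Continuous fun p : ↑(U ∩ V) × (Fin n → ℝ) =>
        (⟨p.1, (φ ⟨p.1, p.1.2.1⟩).symm p.2⟩ : E.Total) :=
      φ2.comp (f := fun p : ↑(U ∩ V) × (Fin n → ℝ) => ((⟨p.1, p.1.2.1⟩ : U), p.2))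
        (((continuous_subtype_val.comp continuous_fst).subtype_mk _).prodMk continuous_snd)
    exact ψ1.comp (f := fun p : ↑(U ∩ V) × (Fin n → ℝ) =>
      (⟨⟨p.1, g p.1 ((φ ⟨p.1, p.1.2.1⟩).symm p.2)⟩, p.1.2.2⟩ :
        {p : F.Total // p.proj ∈ V})) ((hg.comp h1).subtype_mk _)
  have h1 : Continuous fun p : {p : F.Total // p.proj ∈ U ∩ V} =>
      ψ ⟨p.1.proj, p.2.2⟩ p.1.snd :=
    ψ1.comp (f := fun p : {p : F.Total // p.proj ∈ U ∩ V} =>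
      (⟨p.1, p.2.2⟩ : {p : F.Total // p.proj ∈ V})) (continuous_subtype_val.subtype_mk _)
  have h2 := (continuous_linearEquiv_symm_apply γ hγ).comp
    (((F.continuous_proj.comp continuous_subtype_val).subtype_mk fun p => p.2).prodMk h1)
  have h3 := φ2.comp (f := fun p : {p : F.Total // p.proj ∈ U ∩ V} =>
    ((⟨p.1.proj, p.2.1⟩ : U), (γ ⟨p.1.proj, p.2⟩).symm (ψ ⟨p.1.proj, p.2.2⟩ p.1.snd)))
    (((F.continuous_proj.comp continuous_subtype_val).subtype_mk _).prodMk h2)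
  refine h3.congr fun p => ?_
  simp [γ]

/-- If a morphism of real vector bundles over `f` is bijective on the fibres, then the total space
of the source carries the topology of the pullback along `f`. -/
theorem isInducing_of_bijective {B' : Type u} [TopologicalSpace B'] {f : C(B', B)}
    {E : VBundle ℝ B'} {F : VBundle ℝ B} (q : ∀ b, E.Fiber b →ₗ[ℝ] F.Fiber (f b))
    (hq : Continuous fun p : E.Total => (⟨f p.proj, q p.proj p.snd⟩ : F.Total))
    (hb : ∀ b, Function.Bijective (q b)) :
    IsInducing fun p : E.Total => (p.proj, (⟨f p.proj, q p.proj p.snd⟩ : F.Total)) := by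
  let g : ∀ b, E.Fiber b ≃ₗ[ℝ] (F.pullback f).Fiber b := fun b => LinearEquiv.ofBijective (q b) (hb b)
  have hg : Continuous fun p : E.Total => (⟨p.proj, g p.proj p.snd⟩ : (F.pullback f).Total) :=
    (continuous_pullback_iff f F.Fiber _).2 ⟨E.continuous_proj, hq⟩
  have h1 : IsInducing fun p : (F.pullback f).Total =>
      (p.proj, (⟨f p.proj, p.snd⟩ : F.Total)) := ⟨rfl⟩
  -- The comparison map from `E` to the pullback has a continuous left inverse, so it is inducing.
  have h2 : IsInducing fun p : E.Total => (⟨p.proj, g p.proj p.snd⟩ : (F.pullback f).Total) :=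
    IsInducing.of_comp hg (continuous_symm g hg) (by
      convert IsInducing.id using 1
      funext p
      simp)
  exact h1.comp h2

/-- A real vector bundle from local trivializations with finite-dimensional model spaces. -/
@[reducible]
def ofModel (Fiber : B → Type u) [∀ b, AddCommGroup (Fiber b)] [∀ b, Module ℝ (Fiber b)]
    [TopologicalSpace (TotalSpace Unit Fiber)]
    (hp : Continuous fun p : TotalSpace Unit Fiber => p.proj)
    (h : ∀ b, ∃ (U : Set B) (V : Type) (_ : AddCommGroup V) (_ : Module ℝ V)
      (_ : TopologicalSpace V) (n : ℕ) (_ : V ≃L[ℝ] (Fin n → ℝ)) (φ : ∀ x : U, Fiber x ≃ₗ[ℝ] V),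
      IsOpen U ∧ b ∈ U ∧
      Continuous (fun p : {p : TotalSpace Unit Fiber // p.proj ∈ U} =>
        φ ⟨p.1.proj, p.2⟩ p.1.snd) ∧
      Continuous (fun p : U × V => (⟨p.1, (φ p.1).symm p.2⟩ : TotalSpace Unit Fiber))) :
    VBundle ℝ B where
  Fiber := Fiber
  continuous_proj := hp
  locally_trivial b := by
    obtain ⟨U, V, _, _, _, n, e, φ, hU, hb, h1, h2⟩ := h b
    exact ⟨U, n, fun x => (φ x).trans e.toLinearEquiv, hU, hb, e.continuous.comp h1,
      h2.comp (f := fun p : U × (Fin n → ℝ) => (p.1, e.symm p.2))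
        (continuous_fst.prodMk (e.symm.continuous.comp continuous_snd))⟩

/-- The real vector bundle underlying a complex vector bundle. -/
@[reducible]
def toReal (E : VBundle ℂ B) : VBundle ℝ B :=
  ofModel E.Fiber E.continuous_proj fun b => by
    obtain ⟨U, n, φ, hU, hb, h1, h2⟩ := E.locally_trivial b
    exact ⟨U, Fin n → ℂ, inferInstance, inferInstance, inferInstance, _,
      (Module.finBasis ℝ (Fin n → ℂ)).equivFun.toContinuousLinearEquiv,
      fun x => (φ x).restrictScalars ℝ, hU, hb, h1, h2⟩

end VBundle

/-- The real vector bundle underlying an algebra bundle. -/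
@[reducible]
noncomputable def AlgebraBundle.toVBundle {B : Type u} [TopologicalSpace B]
    (A : AlgebraBundle B) : VBundle ℝ B :=
  VBundle.ofModel A.Fiber A.continuous_proj fun b => by
    obtain ⟨U, V, _, _, _, _, _, φ, hU, hb, h1, h2⟩ := A.locally_trivial b
    have := IsModuleTopology.toContinuousAdd ℝ V
    exact ⟨U, V, inferInstance, inferInstance, inferInstance, _,
      { (Module.finBasis ℝ V).equivFun with
        continuous_toFun :=
          IsModuleTopology.continuous_of_linearMap (Module.finBasis ℝ V).equivFun.toLinearMap
        continuous_invFun :=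
          IsModuleTopology.continuous_of_linearMap (Module.finBasis ℝ V).equivFun.symm.toLinearMap },
      fun x => (φ x).toLinearEquiv, hU, hb, h1, h2⟩

/-! ### The double covering: base change to `X` and local sections -/

namespace FreeRealSpace

variable (X : FreeRealSpace.{u})

/-- Continuity of a map on a space over `Y` may be checked after base change to `X`. -/
theorem continuous_of_baseChange {Z T : Type*} [TopologicalSpace Z] [TopologicalSpace T]
    {ρ : Z → X.Quot} (hρ : Continuous ρ) {g : Z → T}
    (h : Continuous fun p : {p : X.carrier × Z // X.proj p.1 = ρ p.2} => g p.1.2) :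
    Continuous g := by
  have hs : Function.Surjective fun p : {p : X.carrier × Z // X.proj p.1 = ρ p.2} => p.1.2 :=
    fun z => by
      obtain ⟨x, hx⟩ := X.proj_surjective (ρ z)
      exact ⟨⟨(x, z), hx⟩, rfl⟩
  -- The covering is open, and openness survives base change: near a point, the image contains the
  -- points of a neighbourhood in `Z` that `ρ` sends into the open image of a neighbourhood in `X`.
  have ho : IsOpenMap fun p : {p : X.carrier × Z // X.proj p.1 = ρ p.2} => p.1.2 := by
    rw [isOpenMap_iff_nhds_le]
    rintro ⟨⟨x, z⟩, hx⟩ s hs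
    obtain ⟨t, ht, hts⟩ := mem_nhds_subtype _ _ _ |>.1 (Filter.mem_map.1 hs)
    obtain ⟨V, hV, W, hW, hVW⟩ := mem_nhds_prod_iff.1 ht
    have h1 : X.proj '' V ∈ 𝓝 (ρ z) := by
      rw [← hx]
      exact X.isOpenMap_proj.image_mem_nhds hV
    filter_upwards [hW, hρ.continuousAt h1] with w hw hw'
    obtain ⟨x', hx', e⟩ := hw'
    exact hts (show (⟨(x', w), e⟩ : {p : X.carrier × Z // X.proj p.1 = ρ p.2}) ∈ _ from hVW ⟨hx', hw⟩)
  exact (ho.isQuotientMap (by fun_prop) hs).continuous_iff.2 h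

/-- Every point has an open neighbourhood that is disjoint from its image under the involution. -/
theorem exists_disjoint_nhds (x : X.carrier) :
    ∃ W : Set X.carrier, IsOpen W ∧ x ∈ W ∧ ∀ z ∈ W, X.inv z ∉ W := by
  obtain ⟨S, T, hS, hT, hxS, hxT, hST⟩ := t2_separation (X.inv_ne x).symm
  exact ⟨S ∩ X.inv ⁻¹' T, hS.inter (hT.preimage X.continuous_inv), ⟨hxS, hxT⟩,
    fun z hz hz' => Set.disjoint_left.1 hST hz'.1 hz.2⟩

/-- The double covering `X → Y` has local sections. -/
theorem exists_local_section (y : X.Quot) :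
    ∃ (U : Set X.Quot) (sec : U → X.carrier), IsOpen U ∧ y ∈ U ∧ Continuous sec ∧
      ∀ u, X.proj (sec u) = u := by
  obtain ⟨x, rfl⟩ := X.proj_surjective y
  obtain ⟨W, hW, hx, hWi⟩ := X.exists_disjoint_nhds x
  have hinj : Function.Injective fun z : W => X.proj z := by
    rintro ⟨a, ha⟩ ⟨b, hb⟩ h
    rcases X.proj_eq.1 h with rfl | rfl
    · rfl
    · exact absurd hb (hWi a ha)
  -- Since `W` is disjoint from its image under the involution, the covering maps it
  -- homeomorphically onto an open set; the inverse is the section.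
  have he : IsOpenEmbedding fun z : W => X.proj z :=
    .of_continuous_injective_isOpenMap (X.proj.continuous.comp continuous_subtype_val) hinj
      (X.isOpenMap_proj.comp hW.isOpenMap_subtype_val)
  let e := he.isEmbedding.toHomeomorph
  exact ⟨_, fun u => e.symm u, he.isOpen_range, ⟨⟨x, hx⟩, rfl⟩,
    continuous_subtype_val.comp e.symm.continuous, fun u =>
      congrArg Subtype.val (e.apply_symm_apply u)⟩

end FreeRealSpace

/-! ### Quotient maps from Real bundles to Clifford module bundles -/

/-- A preimage is the conjugate of `v`. It lies in the fibre over `inv (inv x)`, which equals `x`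
only propositionally, so the base point is generalized before it is identified with `x`. -/
theorem RealBundle.conj_surjective {X : RealSpace.{u}} (E : RealBundle X) (x : X.carrier)
    (v : E.Fiber (X.inv x)) : ∃ w : E.Fiber x, E.conj x w = v := by
  have h := E.conj_conj ⟨X.inv x, v⟩
  obtain ⟨y, w, hw, e⟩ : ∃ (y : X.carrier) (w : E.Fiber y) (_ : y = x),
      (⟨X.inv y, E.conj y w⟩ : E.Total) = ⟨X.inv x, v⟩ := ⟨_, _, X.inv_inv x, h⟩
  subst hw
  exact ⟨w, by simpa using e⟩

/-- A map `q : E → F` that exhibits `F` as the quotient `E / (ℤ/2)`. -/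
structure CliffordQuotientMap {X : FreeRealSpace.{u}} (E : RealBundle X.toRealSpace)
    (F : ModuleBundle X.cliffordBundle) where
  app : ∀ x, E.Fiber x →ₗ[ℝ] F.Fiber (X.proj x)
  continuous_app : Continuous fun p : E.Total => (⟨X.proj p.proj, app p.proj p.snd⟩ : F.Total)
  bijective : ∀ x, Function.Bijective (app x)
  app_conj : ∀ x v, (⟨X.proj (X.inv x), app (X.inv x) (E.conj x v)⟩ : F.Total) =
    ⟨X.proj x, app x v⟩
  app_I : ∀ x v, app x (Complex.I • v) =
    F.action (X.proj x) (X.cliffordι (X.proj x) (X.lineClass x 1)) (app x v)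

theorem IsCliffordQuotient.nonempty {X : FreeRealSpace.{u}} {E : RealBundle X.toRealSpace}
    {F : ModuleBundle X.cliffordBundle} (h : IsCliffordQuotient E F) :
    Nonempty (CliffordQuotientMap E F) :=
  let ⟨q, h1, h2, h3, h4⟩ := h
  ⟨⟨q, h1, h2, h3, h4⟩⟩

namespace CliffordQuotientMap

variable {X : FreeRealSpace.{u}} {E E' : RealBundle X.toRealSpace}
  {F F' : ModuleBundle X.cliffordBundle}

/-- The map of total spaces. -/
def total (q : CliffordQuotientMap E F) (p : E.Total) : F.Total :=
  ⟨X.proj p.proj, q.app p.proj p.snd⟩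

/-- A fibrewise bijection identifies `E` with the pullback of `F`. This is the continuity criterion
for maps into `E` in the descent and the lifting of morphisms. -/
theorem isInducing (q : CliffordQuotientMap E F) :
    IsInducing fun p : E.Total => (p.proj, q.total p) :=
  VBundle.isInducing_of_bijective (f := X.proj) (E := E.toReal) (F := F.toVBundle)
    q.app q.continuous_app q.bijective

/-- The isomorphism of fibres. -/
noncomputable def equiv (q : CliffordQuotientMap E F) (x : X.carrier) :
    E.Fiber x ≃ₗ[ℝ] F.Fiber (X.proj x) :=
  LinearEquiv.ofBijective (q.app x) (q.bijective x)

theorem exists_total_eq (q : CliffordQuotientMap E F) (x : X.carrier) (s : F.Total)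
    (h : X.proj x = s.proj) : ∃ p : E.Total, p.proj = x ∧ q.total p = s := by
  obtain ⟨y, s⟩ := s
  obtain rfl : X.proj x = y := h
  obtain ⟨v, rfl⟩ := (q.bijective x).2 s
  exact ⟨⟨x, v⟩, rfl, rfl⟩

theorem app_eq (q : CliffordQuotientMap E F) {x : X.carrier} {v : E.Fiber x}
    {s : F.Fiber (X.proj x)} : q.total ⟨x, v⟩ = ⟨X.proj x, s⟩ ↔ q.app x v = s := by
  simp [total]

/-- A morphism of Real bundles commutes with a linear map between the quotients. -/
theorem exists_descend (q : CliffordQuotientMap E F) (q' : CliffordQuotientMap E' F')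
    (g : E.Hom E') (y : X.Quot) : ∃ h : F.Fiber y →ₗ[ℝ] F'.Fiber y,
      ∀ x v s, q.total ⟨x, v⟩ = ⟨y, s⟩ → q'.total ⟨x, g.app x v⟩ = ⟨y, h s⟩ := by
  obtain ⟨x, rfl⟩ := X.proj_surjective y
  -- The map is defined through one point `x` of the orbit; compatibility of `g` with the
  -- involutions gives the same map at the other point.
  let h : F.Fiber (X.proj x) →ₗ[ℝ] F'.Fiber (X.proj x) :=
    (q'.app x).comp (((g.app x).restrictScalars ℝ).comp (q.equiv x).symm.toLinearMap)
  have key : ∀ v : E.Fiber x, h (q.app x v) = q'.app x (g.app x v) := fun v => by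
    have : (q.equiv x).symm (q.app x v) = v := (q.equiv x).symm_apply_apply v
    simp [h, this]
  refine ⟨h, fun x' v s hs => ?_⟩
  rcases X.proj_eq.1 (show X.proj x = X.proj x' from congrArg TotalSpace.proj hs.symm) with
    rfl | rfl
  · rw [q.app_eq] at hs
    rw [q'.app_eq, ← hs, key]
  · obtain ⟨w, rfl⟩ := E.conj_surjective x v
    have h1 := (q.app_conj x w).symm.trans hs
    rw [g.map_conj]
    refine (q'.app_conj x _).trans ?_
    obtain rfl : q.app x w = s := q.app_eq.1 h1
    rw [key]

/-- The algebra `C⁻(L)_y` is generated by the class `[x, 1]`. -/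
theorem map_action_of_map_lineClass {V W : Type*} [AddCommGroup V] [Module ℝ V] [AddCommGroup W]
    [Module ℝ W] (x : X.carrier)
    (ρ : X.cliffordBundle.Fiber (X.proj x) →ₐ[ℝ] Module.End ℝ V)
    (ρ' : X.cliffordBundle.Fiber (X.proj x) →ₐ[ℝ] Module.End ℝ W) (h : V →ₗ[ℝ] W)
    (hh : ∀ v, h (ρ (X.cliffordι _ (X.lineClass x 1)) v) =
      ρ' (X.cliffordι _ (X.lineClass x 1)) (h v))
    (a : X.cliffordBundle.Fiber (X.proj x)) (v : V) : h (ρ a v) = ρ' a (h v) := by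
  revert v
  refine CliffordAlgebra.induction (Q := -(X.lineMetric (X.proj x)))
    (C := fun a => ∀ v, h (ρ a v) = ρ' a (h v)) (fun r v => ?_) (fun l v => ?_)
    (fun a b ha hb v => ?_) (fun a b ha hb v => ?_) a
  · have h1 : ρ (algebraMap ℝ (X.cliffordBundle.Fiber (X.proj x)) r) v = r • v := by simp
    have h2 : ρ' (algebraMap ℝ (X.cliffordBundle.Fiber (X.proj x)) r) (h v) = r • h v := by simp
    exact (congrArg h h1).trans ((map_smul h r v).trans h2.symm)
  · obtain ⟨t, rfl⟩ := (X.lineEquiv (X.proj x) ⟨x, rfl⟩).surjective l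
    have e : X.cliffordι _ (X.lineEquiv (X.proj x) ⟨x, rfl⟩ t) =
        t • X.cliffordι _ (X.lineClass x 1) := by
      rw [← map_smul]
      refine congrArg _ (Eq.trans ?_ (map_smul (X.lineEquiv (X.proj x) ⟨x, rfl⟩) t 1))
      rw [smul_eq_mul, mul_one]
    change h (ρ (X.cliffordι _ _) v) = ρ' (X.cliffordι _ _) (h v)
    rw [e, map_smul, map_smul, LinearMap.smul_apply, LinearMap.smul_apply, map_smul, hh]
  · exact (congrArg h (LinearMap.congr_fun (map_mul ρ a b) v)).trans
      ((ha _).trans ((congrArg (ρ' a) (hb v)).trans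
        (LinearMap.congr_fun (map_mul ρ' a b) (h v)).symm))
  · have h1 := LinearMap.congr_fun (map_add ρ a b) v
    have h2 := LinearMap.congr_fun (map_add ρ' a b) (h v)
    refine (congrArg h h1).trans (Eq.trans ?_ h2.symm)
    exact (map_add h _ _).trans (congrArg₂ (· + ·) (ha v) (hb v))

/-- Morphisms of Real bundles descend to the quotients. -/
theorem exists_hom_of_hom (q : CliffordQuotientMap E F) (q' : CliffordQuotientMap E' F')
    (g : E.Hom E') : ∃ h : F.Hom F', ∀ x v, h.app (X.proj x) (q.app x v) = q'.app x (g.app x v) := by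
  choose h hh using exists_descend q q' g
  have key : ∀ x v, h (X.proj x) (q.app x v) = q'.app x (g.app x v) := fun x v =>
    (q'.app_eq.1 (hh _ x v _ rfl)).symm
  have hc : Continuous fun p : F.Total => (⟨p.proj, h p.proj p.snd⟩ : F'.Total) := by
    -- After base change, a point of `F` together with a point `x` of its orbit has a lift `e` to
    -- `E` over `x`. The lift is continuous by `isInducing`, and the map becomes `q' ∘ g ∘ e`.
    refine X.continuous_of_baseChange F.continuous_proj ?_
    choose e he he' using fun p : {p : X.carrier × F.Total // X.proj p.1 = p.2.proj} =>
      q.exists_total_eq p.1.1 p.1.2 p.2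
    have hce : Continuous e := by
      refine q.isInducing.continuous_iff.2 (Continuous.congr continuous_subtype_val fun p => ?_)
      exact Prod.ext (he p).symm (he' p).symm
    refine (q'.continuous_app.comp (g.continuous_app.comp hce)).congr fun p => ?_
    exact hh _ _ _ _ (he' p)
  refine ⟨⟨⟨h, hc⟩, fun y a s => ?_⟩, key⟩
  obtain ⟨x, rfl⟩ := X.proj_surjective y
  -- Only the generator `[x, 1]` needs checking, and there the action is multiplication by `i`, with
  -- which `g` commutes.
  refine map_action_of_map_lineClass x _ _ _ (fun s => ?_) a s
  obtain ⟨v, rfl⟩ := (q.bijective x).2 s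
  rw [← q.app_I, key, key, map_smul, q'.app_I]

/-- Morphisms between the quotients lift to the Real bundles. -/
theorem exists_hom_lift (q : CliffordQuotientMap E F) (q' : CliffordQuotientMap E' F')
    (h : F.Hom F') : ∃ g : E.Hom E', ∀ x v, h.app (X.proj x) (q.app x v) = q'.app x (g.app x v) := by
  let g₀ : ∀ x, E.Fiber x →ₗ[ℝ] E'.Fiber x := fun x =>
    (q'.equiv x).symm.toLinearMap.comp ((h.app (X.proj x)).comp (q.app x))
  have key : ∀ x v, q'.app x (g₀ x v) = h.app (X.proj x) (q.app x v) := fun x v =>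
    (q'.equiv x).apply_symm_apply _
  have hI : ∀ x v, g₀ x (Complex.I • v) = Complex.I • g₀ x v := fun x v => by
    apply (q'.bijective x).1
    rw [key, q.app_I, h.map_action, q'.app_I, key]
  let g : ∀ x, E.Fiber x →ₗ[ℂ] E'.Fiber x := fun x =>
    { g₀ x with
      map_smul' := fun c v => by
        change g₀ x (c • v) = c • g₀ x v
        rw [← Complex.re_add_im c, add_smul, add_smul, mul_smul, mul_smul, map_add,
          Complex.coe_smul, Complex.coe_smul, Complex.coe_smul, Complex.coe_smul,
          map_smul, map_smul, hI] }
  have hg : ∀ x v, q'.app x (g x v) = h.app (X.proj x) (q.app x v) := key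
  have hc : Continuous fun p : E.Total => (⟨p.proj, g p.proj p.snd⟩ : E'.Total) := by
    refine q'.isInducing.continuous_iff.2 (E.continuous_proj.prodMk ?_)
    refine (h.continuous_app.comp q.continuous_app).congr fun p => ?_
    exact (q'.app_eq.2 (hg _ _)).symm
  refine ⟨⟨⟨g, hc⟩, fun x v => (q'.bijective _).1 ?_⟩, fun x v => (hg x v).symm⟩
  rw [hg]
  refine q'.app_eq.1 ((q'.app_conj x _).trans ?_) |>.symm
  rw [hg]
  exact (congrArg (fun p : F.Total => (⟨p.proj, h.app p.proj p.snd⟩ : F'.Total))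
    (q.app_conj x v)).symm

end CliffordQuotientMap

/-! ### Direct sums and pullbacks under the quotient relation -/

variable {X : FreeRealSpace.{u}} {E E₁ E₂ : RealBundle X.toRealSpace}
  {F F₁ F₂ : ModuleBundle X.cliffordBundle}

/-- The four structure maps of a biproduct descend, and their identities can be checked after the
surjections `q`. Since the quotients are arbitrary, this also covers uniqueness of the quotient up
to a zero summand. -/
theorem IsCliffordQuotient.isSum (r : IsCliffordQuotient E F) (r₁ : IsCliffordQuotient E₁ F₁)
    (r₂ : IsCliffordQuotient E₂ F₂) (h : E.IsSum E₁ E₂) : F.IsSum F₁ F₂ := by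
  obtain ⟨q⟩ := r.nonempty
  obtain ⟨q₁⟩ := r₁.nonempty
  obtain ⟨q₂⟩ := r₂.nonempty
  obtain ⟨i₁, i₂, p₁, p₂, h₁, h₂, h⟩ := h
  obtain ⟨i₁', hi₁⟩ := q₁.exists_hom_of_hom q i₁
  obtain ⟨i₂', hi₂⟩ := q₂.exists_hom_of_hom q i₂
  obtain ⟨p₁', hp₁⟩ := q.exists_hom_of_hom q₁ p₁
  obtain ⟨p₂', hp₂⟩ := q.exists_hom_of_hom q₂ p₂
  refine ⟨i₁', i₂', p₁', p₂', fun y s => ?_, fun y s => ?_, fun y s => ?_⟩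
  · obtain ⟨x, rfl⟩ := X.proj_surjective y
    obtain ⟨v, rfl⟩ := (q₁.bijective x).2 s
    rw [hi₁, hp₁, h₁]
  · obtain ⟨x, rfl⟩ := X.proj_surjective y
    obtain ⟨v, rfl⟩ := (q₂.bijective x).2 s
    rw [hi₂, hp₂, h₂]
  · obtain ⟨x, rfl⟩ := X.proj_surjective y
    obtain ⟨v, rfl⟩ := (q.bijective x).2 s
    rw [hp₁, hp₂, hi₁, hi₂, ← map_add, h]

/-- Dually, the structure maps lift, and the injections `q` detect the identities. -/
theorem IsCliffordQuotient.isSum_lift (r : IsCliffordQuotient E F) (r₁ : IsCliffordQuotient E₁ F₁)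
    (r₂ : IsCliffordQuotient E₂ F₂) (h : F.IsSum F₁ F₂) : E.IsSum E₁ E₂ := by
  obtain ⟨q⟩ := r.nonempty
  obtain ⟨q₁⟩ := r₁.nonempty
  obtain ⟨q₂⟩ := r₂.nonempty
  obtain ⟨i₁, i₂, p₁, p₂, h₁, h₂, h⟩ := h
  obtain ⟨i₁', hi₁⟩ := q₁.exists_hom_lift q i₁
  obtain ⟨i₂', hi₂⟩ := q₂.exists_hom_lift q i₂
  obtain ⟨p₁', hp₁⟩ := q.exists_hom_lift q₁ p₁
  obtain ⟨p₂', hp₂⟩ := q.exists_hom_lift q₂ p₂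
  refine ⟨i₁', i₂', p₁', p₂', fun x v => (q₁.bijective x).1 ?_, fun x v => (q₂.bijective x).1 ?_,
    fun x v => (q.bijective x).1 ?_⟩
  · rw [← hp₁, ← hi₁, h₁]
  · rw [← hp₂, ← hi₂, h₂]
  · rw [map_add, ← hi₁, ← hi₂, ← hp₁, ← hp₂, h]

/-- The relation `F = E / (ℤ/2)` is compatible with pullbacks. -/
theorem IsCliffordQuotient.pullback {X' : FreeRealSpace.{u}}
    (f : X'.toRealSpace.Hom X.toRealSpace) (r : IsCliffordQuotient E F) :
    IsCliffordQuotient (E.pullback f) (F.pullback (FreeRealSpace.cliffordMap f)) := by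
  obtain ⟨q⟩ := r.nonempty
  refine ⟨fun x => q.app (f.toMap x), ?_, fun x => q.bijective (f.toMap x), fun x v => ?_,
    fun x v => ?_⟩
  · exact (continuous_pullback_iff (FreeRealSpace.quotMap f) F.Fiber _).2
      ⟨X'.proj.continuous.comp (E.pullback f).continuous_proj,
        q.continuous_app.comp (E.continuous_pullbackMap f.toMap)⟩
  · refine pullback_ext (FreeRealSpace.quotMap f) F.Fiber (X'.proj_inv x) ?_
    refine Eq.trans ?_ (q.app_conj (f.toMap x) v)
    exact congrArg q.total (E.mk_fiberCast (f.map_inv x).symm _)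
  · refine (q.app_I (f.toMap x) v).trans ?_
    have : FreeRealSpace.cliffordMapFiber f (X'.proj x)
        (X'.cliffordι (X'.proj x) (X'.lineClass x 1)) =
        X.cliffordι (X.proj (f.toMap x)) (X.lineClass (f.toMap x) 1) := by
      refine (CliffordAlgebra.map_apply_ι _ _).trans ?_
      exact congrArg (CliffordAlgebra.ι _) (FreeRealSpace.lineMap_lineEquiv f _ _ _)
    exact (congrArg (fun a => F.action (X.proj (f.toMap x)) a (q.app (f.toMap x) v)) this).symm

/-! ### The fibres of `C⁻(L)` -/

/-- Scalar multiplication is continuous on the total space of a vector bundle. -/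
theorem VBundle.continuous_smul {𝕜 : Type} [RCLike 𝕜] {B : Type u} [TopologicalSpace B]
    (E : VBundle 𝕜 B) :
    Continuous fun p : 𝕜 × E.Total => (⟨p.2.proj, p.1 • p.2.snd⟩ : E.Total) := by
  refine continuous_of_cover (E.continuous_proj.comp continuous_snd) fun b => ?_
  obtain ⟨U, n, φ, hU, hb, h1, h2⟩ := E.locally_trivial b
  refine ⟨U, hU, hb, ?_⟩
  have h3 := h1.comp (f := fun p : {p : 𝕜 × E.Total // p.2.proj ∈ U} =>
    (⟨p.1.2, p.2⟩ : {p : E.Total // p.proj ∈ U}))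
    ((continuous_snd.comp continuous_subtype_val).subtype_mk _)
  have h4 := h2.comp (f := fun p : {p : 𝕜 × E.Total // p.2.proj ∈ U} =>
    ((⟨p.1.2.proj, p.2⟩ : U), p.1.1 • φ ⟨p.1.2.proj, p.2⟩ p.1.2.snd))
    (((E.continuous_proj.comp (continuous_snd.comp continuous_subtype_val)).subtype_mk _).prodMk
      ((continuous_fst.comp continuous_subtype_val).smul h3))
  refine h4.congr fun p => ?_
  simp

theorem linearMap_complex_eq {M : Type*} [AddCommGroup M] [Module ℝ M] {f g : ℂ →ₗ[ℝ] M}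
    (h1 : f 1 = g 1) (hI : f Complex.I = g Complex.I) (c : ℂ) : f c = g c := by
  have hc : c = c.re • (1 : ℂ) + c.im • Complex.I := by
    conv_lhs => rw [← Complex.re_add_im c]
    simp
  rw [hc, map_add, map_add, map_smul, map_smul, map_smul, map_smul, h1, hI]

/-- The trivial complex line bundle, as a real vector bundle. -/
noncomputable def VBundle.trivialComplex (B : Type u) [TopologicalSpace B] : VBundle ℝ B :=
  letI : TopologicalSpace (TotalSpace Unit fun _ : B => ULift.{u} ℂ) :=
    TopologicalSpace.induced (fun p => (p.proj, p.snd.down)) inferInstance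
  have hi : Continuous fun p : TotalSpace Unit fun _ : B => ULift.{u} ℂ => (p.proj, p.snd.down) :=
    continuous_induced_dom
  VBundle.ofModel (fun _ => ULift.{u} ℂ) (continuous_fst.comp hi) fun _ =>
    ⟨Set.univ, ℂ, inferInstance, inferInstance, inferInstance, _,
      (Module.finBasis ℝ ℂ).equivFun.toContinuousLinearEquiv, fun _ => ULift.moduleEquiv,
      isOpen_univ, trivial, (continuous_snd.comp hi).comp continuous_subtype_val,
      continuous_induced_rng.2 ((continuous_subtype_val.comp continuous_fst).prodMk continuous_snd)⟩

namespace FreeRealSpace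

variable (X : FreeRealSpace.{u})

/-- The isomorphism `ℂ ≃ C⁻(L)_y` with `i ↦ [x, 1]`, for `x` over `y`. -/
noncomputable def complexEquiv (x : X.carrier) : ℂ ≃ₐ[ℝ] X.cliffordBundle.Fiber (X.proj x) :=
  CliffordAlgebraComplex.equiv.symm.trans (X.cliffordEquiv (X.proj x) ⟨x, rfl⟩)

theorem complexEquiv_I (x : X.carrier) :
    X.complexEquiv x Complex.I = X.cliffordι (X.proj x) (X.lineClass x 1) := by
  have h : CliffordAlgebraComplex.equiv.symm Complex.I =
      CliffordAlgebra.ι CliffordAlgebraComplex.Q 1 := CliffordAlgebraComplex.ofComplex_I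
  exact (congrArg (X.cliffordEquiv (X.proj x) ⟨x, rfl⟩) h).trans (X.cliffordEquiv_ι _ _ _)

/-- The pullback of `C⁻(L)` to `X` is the trivial bundle with fibre `ℂ`, topologically as well as
fibrewise. Hence the complex coefficient of a Clifford element depends continuously on that element
and on the chosen point of the orbit. -/
theorem isInducing_complexEquiv :
    IsInducing fun p : X.carrier × ℂ =>
      (p.1, (⟨X.proj p.1, X.complexEquiv p.1 p.2⟩ : X.cliffordBundle.Total)) := by
  have := IsModuleTopology.topologicalAddGroup ℝ (CliffordAlgebra CliffordAlgebraComplex.Q)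
  have := IsModuleTopology.toContinuousSMul ℝ (CliffordAlgebra CliffordAlgebraComplex.Q)
  have h0 : Continuous fun c : ℂ => CliffordAlgebraComplex.equiv.symm c :=
    LinearMap.continuous_of_finiteDimensional
      CliffordAlgebraComplex.equiv.symm.toLinearEquiv.toLinearMap
  have h1 : Continuous[_, X.cliffordBundle.topTotal]
      (fun p : X.carrier × CliffordAlgebra CliffordAlgebraComplex.Q =>
        (⟨X.proj p.1, X.cliffordEquiv (X.proj p.1) ⟨p.1, rfl⟩ p.2⟩ : X.cliffordBundle.Total)) :=
    continuous_coinduced_rng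
  have h2 : Continuous fun p : X.carrier × ℂ =>
      (⟨X.proj p.1, X.complexEquiv p.1 p.2⟩ : X.cliffordBundle.Total) :=
    h1.comp (continuous_fst.prodMk (h0.comp continuous_snd))
  have hi : IsInducing fun p : (VBundle.trivialComplex X.carrier).Total => (p.proj, p.snd.down) :=
    ⟨rfl⟩
  have h3 := VBundle.isInducing_of_bijective (f := X.proj) (E := VBundle.trivialComplex X.carrier)
    (F := X.cliffordBundle.toVBundle)
    (fun x => (X.complexEquiv x).toLinearMap.comp (ULift.moduleEquiv (R := ℝ)).toLinearMap)
    (h2.comp hi.continuous)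
    (fun x => (X.complexEquiv x).bijective.comp (ULift.moduleEquiv (R := ℝ)).bijective)
  have h4 : IsInducing fun p : X.carrier × ℂ =>
      (⟨p.1, ⟨p.2⟩⟩ : (VBundle.trivialComplex X.carrier).Total) :=
    IsInducing.of_comp (hi.continuous_iff.2 continuous_id) hi.continuous IsInducing.id
  exact h3.comp h4

theorem lineMetric_apply {y : X.Quot} (l : X.lineFiber y) (z : X.Orbit y) :
    X.lineMetric y l = l.1 z * l.1 z := by
  obtain ⟨t, rfl⟩ := (X.lineEquiv y z).surjective l
  rw [lineMetric_lineEquiv]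
  have : (X.lineEquiv y z t).1 z = t := (X.lineEquiv y z).symm_apply_apply t
  rw [this]

end FreeRealSpace

/-! ### The quotient of a Real bundle -/

namespace RealBundle

variable {X : FreeRealSpace.{u}} (E : RealBundle X.toRealSpace)

/-- The involution of the total space. -/
def conjTotal {X : RealSpace.{u}} (E : RealBundle X) (p : E.Total) : E.Total :=
  ⟨X.inv p.proj, E.conj p.proj p.snd⟩

theorem conj_real_smul {X : RealSpace.{u}} (E : RealBundle X) (x : X.carrier) (r : ℝ)
    (v : E.Fiber x) : E.conj x (r • v) = r • E.conj x v := by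
  rw [← Complex.coe_smul, map_smulₛₗ, Complex.conj_ofReal, Complex.coe_smul]

/-- The fibre over `y` of the quotient of `E`: the invariant sections of `E` on the orbit `y`. -/
def quotFiber (y : X.Quot) : Submodule ℝ (∀ z : X.Orbit y, E.Fiber z) where
  carrier := {s | ∀ z, s (X.flip z) = E.conj z (s z)}
  add_mem' {s t} hs ht z := by
    change s (X.flip z) + t (X.flip z) = E.conj z (s z + t z)
    rw [map_add, ← hs z, ← ht z]
    rfl
  zero_mem' z := (map_zero (E.conj z)).symm
  smul_mem' c s hs z := by
    change c • s (X.flip z) = E.conj z (c • s z)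
    rw [E.conj_real_smul, ← hs z]
    rfl

/-- An orbit consists of exactly two points, so an invariant section is given by `v` at `z` and its
conjugate at the other point. Invariance at the second point is involutivity. -/
theorem exists_quotFiber {y : X.Quot} (z : X.Orbit y) (v : E.Fiber z) :
    ∃ s : E.quotFiber y, s.1 z = v := by
  -- The values are specified by equations in the total space, which avoids transport between fibres
  -- over equal points.
  have h : ∀ w : X.Orbit y, ∃ a : E.Fiber w,
      (w = z ∧ (⟨w, a⟩ : E.Total) = ⟨z, v⟩) ∨
      (w = X.flip z ∧ (⟨w, a⟩ : E.Total) = E.conjTotal ⟨z, v⟩) := fun w => by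
    rcases FreeRealSpace.orbit_eq z w with rfl | rfl
    · exact ⟨v, Or.inl ⟨rfl, rfl⟩⟩
    · exact ⟨E.conj z v, Or.inr ⟨rfl, rfl⟩⟩
  choose s hs using h
  have h1 : (⟨z, s z⟩ : E.Total) = ⟨z, v⟩ := by
    rcases hs z with h | h
    · exact h.2
    · exact absurd h.1.symm (FreeRealSpace.flip_ne z)
  have h2 : (⟨X.flip z, s (X.flip z)⟩ : E.Total) = E.conjTotal ⟨z, v⟩ := by
    rcases hs (X.flip z) with h | h
    · exact absurd h.1 (FreeRealSpace.flip_ne z)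
    · exact h.2
  have h3 : s z = v := by simpa using h1
  refine ⟨⟨s, fun w => ?_⟩, h3⟩
  suffices h : (⟨X.flip w, s (X.flip w)⟩ : E.Total) = E.conjTotal ⟨w, s w⟩ from
    TotalSpace.mk_inj.1 h
  rcases FreeRealSpace.orbit_eq z w with rfl | rfl
  · rw [h2, h1]
  · rw [h2]
    have h4 : E.conjTotal (E.conjTotal ⟨z, v⟩) = ⟨z, v⟩ := E.conj_conj ⟨z, v⟩
    rw [h4, ← h1]
    exact congrArg (fun w : X.Orbit y => (⟨w, s w⟩ : E.Total)) (FreeRealSpace.flip_flip z)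

/-- The isomorphism `(E/G)_y ≃ E_x` for a point `x` of the orbit `y`. -/
noncomputable def quotEval (y : X.Quot) (z : X.Orbit y) : E.quotFiber y ≃ₗ[ℝ] E.Fiber z :=
  LinearEquiv.ofBijective
    ((LinearMap.proj z).comp (E.quotFiber y).subtype) ⟨fun s t h => by
      have h' : s.1 z = t.1 z := h
      refine Subtype.ext (funext fun w => ?_)
      rcases FreeRealSpace.orbit_eq z w with rfl | rfl
      · exact h
      · rw [s.2 z, t.2 z, h'], E.exists_quotFiber z⟩

theorem quotEval_apply (y : X.Quot) (z : X.Orbit y) (s : E.quotFiber y) :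
    E.quotEval y z s = s.1 z := rfl

/-- The quotient map on total spaces. -/
noncomputable def quotTotal (p : E.Total) : TotalSpace Unit fun y => E.quotFiber y :=
  ⟨X.proj p.proj, (E.quotEval (X.proj p.proj) ⟨p.proj, rfl⟩).symm p.snd⟩

/-- Either point of the orbit may represent an element of `E/G`, also when the equation `proj z = y`
is not definitional. -/
theorem quotTotal_eval {y : X.Quot} (z : X.Orbit y) (s : E.quotFiber y) :
    E.quotTotal ⟨z, s.1 z⟩ = ⟨y, s⟩ := by
  obtain ⟨x, rfl⟩ := z
  exact TotalSpace.mk_inj.2 ((E.quotEval (X.proj x) ⟨x, rfl⟩).symm_apply_apply s)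

theorem exists_eq_quotTotal {y : X.Quot} (z : X.Orbit y) (v : E.Fiber z) :
    ∃ s : E.quotFiber y, s.1 z = v ∧ E.quotTotal ⟨z, v⟩ = ⟨y, s⟩ := by
  obtain ⟨s, rfl⟩ := E.exists_quotFiber z v
  exact ⟨s, rfl, E.quotTotal_eval z s⟩

theorem quotTotal_conjTotal (p : E.Total) : E.quotTotal (E.conjTotal p) = E.quotTotal p := by
  obtain ⟨x, v⟩ := p
  obtain ⟨s, rfl, h⟩ := E.exists_eq_quotTotal (y := X.proj x) ⟨x, rfl⟩ v
  refine Eq.trans ?_ h.symm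
  rw [← E.quotTotal_eval (X.flip ⟨x, rfl⟩) s, s.2]
  rfl

theorem eq_of_quotTotal_eq {x : X.carrier} {v w : E.Fiber x}
    (h : E.quotTotal ⟨x, v⟩ = E.quotTotal ⟨x, w⟩) : v = w :=
  (E.quotEval (X.proj x) ⟨x, rfl⟩).symm.injective
    ((TotalSpace.mk_inj (E := fun y => ↥(E.quotFiber y))).1 h)

/-- The fibres of `E → E/G` are orbits: the base points agree up to the involution, and over a fixed
base point the map is injective. -/
theorem quotTotal_eq {p p' : E.Total} (h : E.quotTotal p = E.quotTotal p') :
    p' = p ∨ p' = E.conjTotal p := by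
  obtain ⟨x, v⟩ := p
  obtain ⟨x', v'⟩ := p'
  rcases X.proj_eq.1 (congrArg TotalSpace.proj h : X.proj x = X.proj x') with rfl | rfl
  · exact Or.inl (TotalSpace.mk_inj.2 (E.eq_of_quotTotal_eq h).symm)
  · refine Or.inr (TotalSpace.mk_inj.2 (E.eq_of_quotTotal_eq ?_))
    exact h.symm.trans (E.quotTotal_conjTotal ⟨x, v⟩).symm

/-- The topology on the total space of the quotient. -/
@[reducible]
noncomputable def quotTopology : TopologicalSpace (TotalSpace Unit fun y => E.quotFiber y) :=
  TopologicalSpace.coinduced E.quotTotal inferInstance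

attribute [local instance] quotTopology

theorem continuous_quotTotal : Continuous E.quotTotal := continuous_coinduced_rng

/-- The saturation of an open set is its union with its preimage under the involution, which is
open. -/
theorem isOpenMap_quotTotal : IsOpenMap E.quotTotal := fun O hO => by
  have h : E.quotTotal ⁻¹' (E.quotTotal '' O) = O ∪ E.conjTotal ⁻¹' O := by
    ext p
    constructor
    · rintro ⟨p', hp', h⟩
      rcases E.quotTotal_eq h.symm with rfl | rfl
      · exact Or.inl hp'
      · exact Or.inr hp'
    · rintro (h | h)
      · exact ⟨p, h, rfl⟩
      · exact ⟨_, h, E.quotTotal_conjTotal p⟩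
  rw [isOpen_coinduced, h]
  exact hO.union (hO.preimage E.continuous_conj)

theorem continuous_quot_proj :
    Continuous fun p : TotalSpace Unit (fun y => E.quotFiber y) => p.proj :=
  continuous_coinduced_dom.2 (X.proj.continuous.comp E.continuous_proj)

/-- Proved directly, since `E/G` is not yet known to be a vector bundle. Over a set `W` disjoint
from its image under the involution, a vector is determined by its class, because its conjugate lies
outside `W`; openness of the quotient map does the rest. -/
theorem isInducing_quotTotal : IsInducing fun p : E.Total => (p.proj, E.quotTotal p) := by
  refine isInducing_iff_nhds.2 fun p => le_antisymm ?_ ?_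
  · exact (E.continuous_proj.prodMk E.continuous_quotTotal).continuousAt.le_comap
  · refine (nhds_basis_opens p).ge_iff.2 fun O hO => ?_
    obtain ⟨W, hW, hpW, hWi⟩ := X.exists_disjoint_nhds p.proj
    have h1 : E.quotTotal '' (O ∩ (fun p : E.Total => p.proj) ⁻¹' W) ∈ 𝓝 (E.quotTotal p) :=
      (E.isOpenMap_quotTotal _ (hO.2.inter (hW.preimage E.continuous_proj))).mem_nhds
        ⟨p, ⟨hO.1, hpW⟩, rfl⟩
    refine ⟨_, prod_mem_nhds (hW.mem_nhds hpW) h1, ?_⟩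
    rintro w ⟨hw, p', ⟨hp', hpW'⟩, h⟩
    rcases E.quotTotal_eq h with rfl | rfl
    · exact hp'
    · exact absurd hw (hWi _ hpW')

/-- The real vector bundle `E/G`. -/
noncomputable def quotVBundle : VBundle ℝ X.Quot :=
  VBundle.ofModel (fun y => E.quotFiber y) E.continuous_quot_proj fun y => by
    obtain ⟨U, sec, hU, hy, hs, hsec⟩ := X.exists_local_section y
    obtain ⟨V, n, φ, hV, hb, φ1, φ2⟩ := E.locally_trivial (sec ⟨y, hy⟩)
    -- The neighbourhood `U` is shrunk to the points whose chosen lift lies where `E` is trivialized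
    -- by `φ`. Evaluation at that lift, followed by `φ`, trivializes `E/G`.
    have hW : IsOpen (Subtype.val '' (sec ⁻¹' V)) := hU.isOpenMap_subtype_val _ (hV.preimage hs)
    have hWU : ∀ u : ↑(Subtype.val '' (sec ⁻¹' V)), u.1 ∈ U := by
      rintro ⟨_, u, _, rfl⟩
      exact u.2
    have hWV : ∀ u : ↑(Subtype.val '' (sec ⁻¹' V)), sec ⟨u, hWU u⟩ ∈ V := by
      rintro ⟨_, u, h, rfl⟩
      exact h
    let σ : ∀ u : ↑(Subtype.val '' (sec ⁻¹' V)), X.Orbit u.1 :=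
      fun u => ⟨sec ⟨u, hWU u⟩, hsec ⟨u, hWU u⟩⟩
    have hσ : Continuous fun u => (σ u).1 := hs.comp (continuous_subtype_val.subtype_mk _)
    have hE : Continuous fun p : {p : TotalSpace Unit (fun y => E.quotFiber y) //
        p.proj ∈ Subtype.val '' (sec ⁻¹' V)} =>
        (⟨σ ⟨p.1.proj, p.2⟩, p.1.snd.1 (σ ⟨p.1.proj, p.2⟩)⟩ : E.Total) := by
      refine E.isInducing_quotTotal.continuous_iff.2 (Continuous.prodMk ?_ ?_)
      · exact hσ.comp ((E.continuous_quot_proj.comp continuous_subtype_val).subtype_mk _)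
      · exact continuous_subtype_val.congr fun p => (E.quotTotal_eval _ p.1.snd).symm
    refine ⟨Subtype.val '' (sec ⁻¹' V), Fin n → ℂ, inferInstance, inferInstance, inferInstance, _,
      (Module.finBasis ℝ (Fin n → ℂ)).equivFun.toContinuousLinearEquiv,
      fun u => (E.quotEval u (σ u)).trans ((φ ⟨σ u, hWV u⟩).restrictScalars ℝ),
      hW, ⟨⟨y, hy⟩, hb, rfl⟩, ?_, ?_⟩
    · exact φ1.comp (f := fun p : {p : TotalSpace Unit (fun y => E.quotFiber y) //
        p.proj ∈ Subtype.val '' (sec ⁻¹' V)} =>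
        (⟨⟨σ ⟨p.1.proj, p.2⟩, p.1.snd.1 (σ ⟨p.1.proj, p.2⟩)⟩, hWV _⟩ :
          {p : E.Total // p.proj ∈ V})) (hE.subtype_mk _)
    · have h := E.continuous_quotTotal.comp (φ2.comp
        (f := fun p : ↑(Subtype.val '' (sec ⁻¹' V)) × (Fin n → ℂ) =>
          ((⟨σ p.1, hWV p.1⟩ : V), p.2))
        (((hσ.comp continuous_fst).subtype_mk _).prodMk continuous_snd))
      refine h.congr fun p => ?_
      obtain ⟨s, hs, h⟩ := E.exists_eq_quotTotal (σ p.1) ((φ ⟨σ p.1, hWV p.1⟩).symm p.2)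
      refine h.trans (TotalSpace.mk_inj.2 ?_)
      change s = (E.quotEval _ _).symm _
      rw [LinearEquiv.eq_symm_apply, quotEval_apply, hs]
      rfl

/-- The multiplication by the elements of `L_y` on the fibre of `E/G` over `y`. -/
noncomputable def lineAction (y : X.Quot) :
    X.lineFiber y →ₗ[ℝ] Module.End ℝ (E.quotFiber y) :=
  LinearMap.mk₂ ℝ (fun l s => ⟨fun z => (l.1 z * Complex.I) • s.1 z, fun z => by
      -- The product is again an invariant section: the sign from `l (flip z) = -l z` cancels the
      -- one from conjugating `i`.
      refine (congrArg₂ (fun (r : ℝ) (w : E.Fiber (X.flip z)) => ((r : ℂ) * Complex.I) • w)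
        (l.2 z) (s.2 z)).trans ?_
      change (((-(l.1 z) : ℝ) : ℂ) * Complex.I) • E.conj z (s.1 z) =
        E.conj z ((l.1 z * Complex.I) • s.1 z)
      rw [map_smulₛₗ]
      simp⟩)
    (fun l l' s => Subtype.ext <| funext fun z => by
      change ((l.1 z + l'.1 z : ℝ) * Complex.I) • s.1 z =
        (l.1 z * Complex.I) • s.1 z + (l'.1 z * Complex.I) • s.1 z
      rw [← add_smul, ← add_mul, Complex.ofReal_add])
    (fun c l s => Subtype.ext <| funext fun z => by
      change ((c * l.1 z : ℝ) * Complex.I) • s.1 z = c • (l.1 z * Complex.I) • s.1 z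
      rw [← Complex.coe_smul, smul_smul, Complex.ofReal_mul, mul_assoc])
    (fun l s s' => Subtype.ext <| funext fun z => smul_add _ _ _)
    (fun c l s => Subtype.ext <| funext fun z => by
      change (l.1 z * Complex.I) • c • s.1 z = c • (l.1 z * Complex.I) • s.1 z
      rw [smul_comm])

/-- The action of `C⁻(L)_y` on the fibre of `E/G` over `y`. -/
noncomputable def quotAction (y : X.Quot) :
    X.cliffordBundle.Fiber y →ₐ[ℝ] Module.End ℝ (E.quotFiber y) :=
  CliffordAlgebra.lift (-(X.lineMetric y)) ⟨E.lineAction y, fun l => by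
    refine LinearMap.ext fun s => Subtype.ext <| funext fun z => ?_
    have h : (-(X.lineMetric y)) l = -(l.1 z * l.1 z) :=
      congrArg Neg.neg (X.lineMetric_apply l z)
    rw [h]
    -- The Clifford relation for the opposite metric: `(l z · i)² = -(l z)²`.
    change (l.1 z * Complex.I) • (l.1 z * Complex.I) • s.1 z = (-(l.1 z * l.1 z)) • s.1 z
    rw [smul_smul, ← Complex.coe_smul]
    congr 1
    push_cast
    linear_combination (l.1 z : ℂ) ^ 2 * Complex.I_mul_I⟩

theorem quotAction_lineClass (x : X.carrier) (v : E.Fiber x) :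
    E.quotAction (X.proj x) (X.cliffordι (X.proj x) (X.lineClass x 1))
      ((E.quotEval (X.proj x) ⟨x, rfl⟩).symm v) =
      (E.quotEval (X.proj x) ⟨x, rfl⟩).symm (Complex.I • v) := by
  have h : E.quotAction (X.proj x) (X.cliffordι (X.proj x) (X.lineClass x 1)) =
      E.lineAction (X.proj x) (X.lineClass x 1) := CliffordAlgebra.lift_ι_apply _ _ _
  have h1 : (X.lineClass x 1).1 ⟨x, rfl⟩ = (1 : ℝ) :=
    (X.lineEquiv (X.proj x) ⟨x, rfl⟩).symm_apply_apply 1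
  have h2 : ((E.quotEval (X.proj x) ⟨x, rfl⟩).symm v).1 ⟨x, rfl⟩ = v :=
    (E.quotEval (X.proj x) ⟨x, rfl⟩).apply_symm_apply v
  rw [h, LinearEquiv.eq_symm_apply]
  refine (congrArg₂ (fun (r : ℝ) (w : E.Fiber x) => ((r : ℂ) * Complex.I) • w) h1 h2).trans ?_
  simp

/-- Both sides are `ℝ`-linear in `c`, so the values at `1` and `i` decide. Over `X`, the Clifford
action thereby becomes complex scalar multiplication on `E`, whose continuity is known. -/
theorem quotAction_complexEquiv (x : X.carrier) (c : ℂ) (v : E.Fiber x) :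
    E.quotAction (X.proj x) (X.complexEquiv x c) ((E.quotEval (X.proj x) ⟨x, rfl⟩).symm v) =
      (E.quotEval (X.proj x) ⟨x, rfl⟩).symm (c • v) := by
  let e := E.quotEval (X.proj x) ⟨x, rfl⟩
  refine linearMap_complex_eq
    (f := (LinearMap.applyₗ (e.symm v)).comp
      ((E.quotAction (X.proj x)).toLinearMap.comp (X.complexEquiv x).toLinearMap))
    (g := e.symm.toLinearMap.comp ((LinearMap.toSpanSingleton ℂ _ v).restrictScalars ℝ)) ?_ ?_ c
  · change E.quotAction (X.proj x) (X.complexEquiv x 1) (e.symm v) = e.symm ((1 : ℂ) • v)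
    rw [map_one, map_one, one_smul]
    rfl
  · change E.quotAction (X.proj x) (X.complexEquiv x Complex.I) (e.symm v) =
      e.symm (Complex.I • v)
    rw [X.complexEquiv_I]
    exact E.quotAction_lineClass x v

/-- The `C⁻(L)`-module bundle `E/G`. -/
noncomputable def quotient : ModuleBundle X.cliffordBundle where
  toVBundle := E.quotVBundle
  action := E.quotAction
  continuous_action := by
    have hd := (FiberBundle.Prod.isInducing_diag Unit X.cliffordBundle.Fiber Unit
      (fun y => E.quotFiber y)).continuous
    -- With a point of the orbit given, the Clifford element becomes a complex number `c` and the
    -- vector a vector `e` of `E`, both depending continuously on the data. The action is then the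
    -- class of `c • e`.
    refine X.continuous_of_baseChange (X.cliffordBundle.continuous_proj.comp hd.fst) ?_
    choose c hc using fun p : {p : X.carrier × TotalSpace (Unit × Unit)
        (X.cliffordBundle.Fiber ×ᵇ fun y => E.quotFiber y) // X.proj p.1 = p.2.proj} =>
      show ∃ c : ℂ, (⟨X.proj p.1.1, X.complexEquiv p.1.1 c⟩ : X.cliffordBundle.Total) =
          ⟨p.1.2.proj, p.1.2.snd.1⟩ by
        obtain ⟨⟨x, y, a, s⟩, h⟩ := p
        obtain rfl : X.proj x = y := h
        obtain ⟨c, rfl⟩ := (X.complexEquiv x).surjective a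
        exact ⟨c, rfl⟩
    choose e he he' using fun p : {p : X.carrier × TotalSpace (Unit × Unit)
        (X.cliffordBundle.Fiber ×ᵇ fun y => E.quotFiber y) // X.proj p.1 = p.2.proj} =>
      show ∃ e : E.Total, e.proj = p.1.1 ∧ E.quotTotal e = ⟨p.1.2.proj, p.1.2.snd.2⟩ by
        obtain ⟨⟨x, y, a, s⟩, h⟩ := p
        obtain rfl : X.proj x = y := h
        exact ⟨_, rfl, E.quotTotal_eval ⟨x, rfl⟩ s⟩
    have hpr : Continuous fun p : {p : X.carrier × TotalSpace (Unit × Unit)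
        (X.cliffordBundle.Fiber ×ᵇ fun y => E.quotFiber y) // X.proj p.1 = p.2.proj} => p.1.2 :=
      continuous_snd.comp continuous_subtype_val
    have hx : Continuous fun p : {p : X.carrier × TotalSpace (Unit × Unit)
        (X.cliffordBundle.Fiber ×ᵇ fun y => E.quotFiber y) // X.proj p.1 = p.2.proj} => p.1.1 :=
      continuous_fst.comp continuous_subtype_val
    have hcc : Continuous c := by
      refine continuous_snd.comp (X.isInducing_complexEquiv.continuous_iff
        (f := fun p => (p.1.1, c p)).2 (hx.prodMk ?_))
      exact (hd.fst.comp hpr).congr fun p => (hc p).symm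
    have hec : Continuous e := by
      refine E.isInducing_quotTotal.continuous_iff.2 (Continuous.prodMk ?_ ?_)
      · exact hx.congr fun p => (he p).symm
      · exact (hd.snd.comp hpr).congr fun p => (he' p).symm
    refine (E.continuous_quotTotal.comp
      (E.continuous_smul.comp (hcc.prodMk hec))).congr fun p => ?_
    have key : ∀ (x : X.carrier) (c : ℂ) (e : E.Total) (y : X.Quot) (a : X.cliffordBundle.Fiber y)
        (s : E.quotFiber y), e.proj = x →
        (⟨X.proj x, X.complexEquiv x c⟩ : X.cliffordBundle.Total) = ⟨y, a⟩ →
        E.quotTotal e = ⟨y, s⟩ → E.quotTotal ⟨e.proj, c • e.snd⟩ = ⟨y, E.quotAction y a s⟩ := by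
      rintro _ c ⟨x, v⟩ y a s rfl ha hs
      obtain rfl : X.proj x = y := congrArg TotalSpace.proj ha
      obtain rfl : X.complexEquiv x c = a := TotalSpace.mk_inj.1 ha
      obtain rfl : (E.quotEval (X.proj x) ⟨x, rfl⟩).symm v = s :=
        (TotalSpace.mk_inj (E := fun y => ↥(E.quotFiber y))).1 hs
      exact TotalSpace.mk_inj.2 (E.quotAction_complexEquiv x c v).symm
    exact key _ _ _ _ _ _ (he p) (hc p) (he' p)

theorem isCliffordQuotient_quotient : IsCliffordQuotient E E.quotient := by
  refine ⟨fun x => (E.quotEval (X.proj x) ⟨x, rfl⟩).symm.toLinearMap, E.continuous_quotTotal,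
    fun x => (E.quotEval (X.proj x) ⟨x, rfl⟩).symm.bijective,
    fun x v => E.quotTotal_conjTotal ⟨x, v⟩, fun x v => (E.quotAction_lineClass x v).symm⟩

end RealBundle

/-! ### Complex structures on real vector bundles -/

namespace VBundle

variable {B : Type u} [TopologicalSpace B]

/-- The complex vector space given by a real vector space with a complex structure. -/
@[reducible]
noncomputable def complexModule {V : Type*} [AddCommGroup V] [Module ℝ V] (J : V →ₗ[ℝ] V)
    (hJ : ∀ v, J (J v) = -v) : Module ℂ V :=
  Module.compHom V (Complex.lift ⟨J, LinearMap.ext hJ⟩ : ℂ →ₐ[ℝ] Module.End ℝ V).toRingHom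

theorem complexModule_smul {V : Type*} [AddCommGroup V] [Module ℝ V] (J : V →ₗ[ℝ] V)
    (hJ : ∀ v, J (J v) = -v) (c : ℂ) (v : V) :
    letI := complexModule J hJ
    c • v = c.re • v + c.im • J v := by
  change (Complex.lift ⟨J, LinearMap.ext hJ⟩ : ℂ →ₐ[ℝ] Module.End ℝ V) c v = _
  simp [Complex.lift, Complex.liftAux_apply]

/-- Averaging makes a linear map commute with complex structures. -/
theorem commutes_average {V W : Type*} [AddCommGroup V] [Module ℝ V] [AddCommGroup W]
    [Module ℝ W] {J : V →ₗ[ℝ] V} {K : W →ₗ[ℝ] W} (hJ : ∀ v, J (J v) = -v)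
    (hK : ∀ v, K (K v) = -v) (A : V →ₗ[ℝ] W) (v : V) :
    ((2⁻¹ : ℝ) • (A - K ∘ₗ A ∘ₗ J)) (J v) = K (((2⁻¹ : ℝ) • (A - K ∘ₗ A ∘ₗ J)) v) := by
  simp [hJ, hK, add_comm]

/-- A complex structure makes `V` a finite-dimensional complex vector space, and any complex basis
gives the frame. -/
theorem exists_complexFrame {V : Type*} [AddCommGroup V] [Module ℝ V] [Module.Finite ℝ V]
    (J : V →ₗ[ℝ] V) (hJ : ∀ v, J (J v) = -v) :
    ∃ (m : ℕ) (e : V ≃ₗ[ℝ] (Fin m → ℂ)), ∀ v, e (J v) = Complex.I • e v := by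
  let _ : Module ℂ V := complexModule J hJ
  have hsmul : ∀ (c : ℂ) (v : V), c • v = c.re • v + c.im • J v := complexModule_smul J hJ
  have : IsScalarTower ℝ ℂ V := ⟨fun r c v => by
    rw [hsmul, hsmul]
    simp [mul_smul]⟩
  have : Module.Finite ℂ V := Module.Finite.of_restrictScalars_finite ℝ ℂ V
  refine ⟨_, (Module.finBasis ℂ V).equivFun.restrictScalars ℝ, fun v => ?_⟩
  have h : J v = Complex.I • v := by simp [hsmul]
  rw [h]
  exact map_smul (Module.finBasis ℂ V).equivFun Complex.I v

/-- In a continuous family of linear maps, invertibility is an open condition. -/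
theorem exists_open_linearEquiv {Z : Type*} [TopologicalSpace Z] {V W : Type*}
    [NormedAddCommGroup V] [NormedSpace ℝ V] [FiniteDimensional ℝ V]
    [NormedAddCommGroup W] [NormedSpace ℝ W] [FiniteDimensional ℝ W]
    (γ : Z → V →ₗ[ℝ] W) (hγ : Continuous fun p : Z × V => γ p.1 p.2) (z : Z)
    (hz : Function.Bijective (γ z)) :
    ∃ (O : Set Z) (f : O → V ≃ₗ[ℝ] W), IsOpen O ∧ z ∈ O ∧ (∀ x v, f x v = γ x v) ∧
      Continuous fun p : O × V => f p.1 p.2 := by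
  have : CompleteSpace V := FiniteDimensional.complete ℝ V
  let G : Z → V →L[ℝ] W := fun x => (γ x).toContinuousLinearMap
  have hG : Continuous G := continuous_clm_apply.2 fun v => hγ.comp (Continuous.prodMk_left v)
  have hf : ∀ x : G ⁻¹' Set.range fun f : V ≃L[ℝ] W => (f : V →L[ℝ] W),
      ∃ f : V ≃ₗ[ℝ] W, ∀ v, f v = γ x v := by
    rintro ⟨x, f, hf⟩
    exact ⟨f.toLinearEquiv, fun v => DFunLike.congr_fun hf v⟩
  choose f hf using hf
  refine ⟨_, f, ContinuousLinearEquiv.isOpen.preimage hG, ?_, hf, ?_⟩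
  · refine ⟨(LinearEquiv.ofBijective (γ z) hz).toContinuousLinearEquiv, ?_⟩
    ext v
    rfl
  · exact (hγ.comp ((continuous_subtype_val.comp continuous_fst).prodMk
      continuous_snd)).congr fun p => (hf _ _).symm

/-- A real trivialization compares nearby fibres with the one over `b` but need not respect `J`.
Averaging it makes it commute with the complex structures; it is the identity at `b`, hence still
invertible nearby, and a complex frame of the single fibre over `b` spreads out. -/
theorem exists_local_complexFrame (E : VBundle ℝ B) (J : ∀ b, E.Fiber b →ₗ[ℝ] E.Fiber b)
    (hJ : ∀ b v, J b (J b v) = -v)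
    (hc : Continuous fun p : E.Total => (⟨p.proj, J p.proj p.snd⟩ : E.Total)) (b : B) :
    ∃ (U : Set B) (n : ℕ) (φ : ∀ x : U, E.Fiber x ≃ₗ[ℝ] (Fin n → ℂ)),
      IsOpen U ∧ b ∈ U ∧ (∀ x v, φ x (J x v) = Complex.I • φ x v) ∧
      Continuous (fun p : {p : E.Total // p.proj ∈ U} => φ ⟨p.1.proj, p.2⟩ p.1.snd) ∧
      Continuous (fun p : U × (Fin n → ℂ) => (⟨p.1, (φ p.1).symm p.2⟩ : E.Total)) := by
  obtain ⟨U, n, φ, hU, hb, φ1, φ2⟩ := E.locally_trivial b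
  have : Module.Finite ℝ (E.Fiber b) := Module.Finite.equiv (φ ⟨b, hb⟩).symm
  obtain ⟨m, e, he⟩ := exists_complexFrame (J b) (hJ b)
  let A : ∀ x : U, E.Fiber x →ₗ[ℝ] E.Fiber b := fun x =>
    (φ ⟨b, hb⟩).symm.toLinearMap ∘ₗ (φ x).toLinearMap
  -- The `J`-linear part of `A x`; the factor `1/2` makes it a projection, so the identity over `b`
  -- is unchanged.
  let T : ∀ x : U, E.Fiber x →ₗ[ℝ] E.Fiber b := fun x =>
    (2⁻¹ : ℝ) • (A x - J b ∘ₗ A x ∘ₗ J x)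
  have hTJ : ∀ x v, T x (J x v) = J b (T x v) := fun x =>
    commutes_average (hJ x) (hJ b) (A x)
  have hTb : ∀ v, T ⟨b, hb⟩ v = v := fun v => by
    have hA : ∀ v, A ⟨b, hb⟩ v = v := fun v => (φ ⟨b, hb⟩).symm_apply_apply v
    change (2⁻¹ : ℝ) • (A ⟨b, hb⟩ v - J b (A ⟨b, hb⟩ (J b v))) = v
    rw [hA, hA, hJ, sub_neg_eq_add, ← two_smul ℝ v, smul_smul]
    norm_num
  let γ : U → (Fin n → ℝ) →ₗ[ℝ] (Fin m → ℂ) := fun x =>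
    e.toLinearMap ∘ₗ T x ∘ₗ (φ x).symm.toLinearMap
  have hγ : Continuous fun p : U × (Fin n → ℝ) => γ p.1 p.2 := by
    have h1 : Continuous fun p : U × (Fin n → ℝ) => φ p.1 (J p.1 ((φ p.1).symm p.2)) :=
      φ1.comp (f := fun p : U × (Fin n → ℝ) =>
        (⟨⟨p.1, J p.1 ((φ p.1).symm p.2)⟩, p.1.2⟩ : {p : E.Total // p.proj ∈ U}))
        ((hc.comp φ2).subtype_mk _)
    have h2 : Continuous ((2⁻¹ : ℝ) • (e.toLinearMap ∘ₗ (φ ⟨b, hb⟩).symm.toLinearMap)) :=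
      LinearMap.continuous_of_finiteDimensional _
    have h3 : Continuous
        ((2⁻¹ : ℝ) • (e.toLinearMap ∘ₗ J b ∘ₗ (φ ⟨b, hb⟩).symm.toLinearMap)) :=
      LinearMap.continuous_of_finiteDimensional _
    refine ((h2.comp continuous_snd).sub (h3.comp h1)).congr fun p => ?_
    simp [γ, T, A, smul_sub]
  -- At `b` the family is an isomorphism composed with the complex frame, and invertibility is an
  -- open condition.
  obtain ⟨O, f, hO, hbO, hf, hfc⟩ := exists_open_linearEquiv γ hγ ⟨b, hb⟩ (by
    have : γ ⟨b, hb⟩ = ((φ ⟨b, hb⟩).symm.trans e).toLinearMap :=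
      LinearMap.ext fun v => congrArg e (hTb _)
    rw [this]
    exact ((φ ⟨b, hb⟩).symm.trans e).bijective)
  have hVU : ∀ x : ↑(Subtype.val '' O), x.1 ∈ U := by
    rintro ⟨_, u, _, rfl⟩
    exact u.2
  have hVO : ∀ x : ↑(Subtype.val '' O), (⟨x.1, hVU x⟩ : U) ∈ O := by
    rintro ⟨_, u, h, rfl⟩
    exact h
  let j : ↑(Subtype.val '' O) → O := fun x => ⟨⟨x.1, hVU x⟩, hVO x⟩
  have hj : Continuous j := (continuous_subtype_val.subtype_mk _).subtype_mk _
  have hft : ∀ (x : O) v, f x (φ x v) = e (T x v) := fun x v =>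
    (hf x _).trans (congrArg (fun w => e (T x w)) ((φ x).symm_apply_apply v))
  refine ⟨Subtype.val '' O, m, fun x => (φ (j x)).trans (f (j x)),
    hU.isOpenMap_subtype_val _ hO, ⟨_, hbO, rfl⟩, fun x v => ?_, ?_, ?_⟩
  · change f (j x) (φ (j x) (J x v)) = Complex.I • f (j x) (φ (j x) v)
    rw [hft, hft, ← he]
    exact congrArg e (hTJ (j x) v)
  · have h1 := φ1.comp (f := fun p : {p : E.Total // p.proj ∈ Subtype.val '' O} =>
      (⟨p.1, hVU ⟨_, p.2⟩⟩ : {p : E.Total // p.proj ∈ U}))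
      (continuous_subtype_val.subtype_mk _)
    exact hfc.comp ((hj.comp ((E.continuous_proj.comp continuous_subtype_val).subtype_mk
      fun p => p.2)).prodMk h1)
  · exact φ2.comp ((continuous_subtype_val.comp (hj.comp continuous_fst)).prodMk
      ((continuous_linearEquiv_symm_apply f hfc).comp ((hj.comp continuous_fst).prodMk
        continuous_snd)))

/-- The complex vector bundle given by a real vector bundle with a complex structure. -/
noncomputable def ofComplexStructure (E : VBundle ℝ B) (J : ∀ b, E.Fiber b →ₗ[ℝ] E.Fiber b)
    (hJ : ∀ b v, J b (J b v) = -v)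
    (hc : Continuous fun p : E.Total => (⟨p.proj, J p.proj p.snd⟩ : E.Total)) : VBundle ℂ B :=
  letI : ∀ b, Module ℂ (E.Fiber b) := fun b => complexModule (J b) (hJ b)
  { Fiber := E.Fiber
    continuous_proj := E.continuous_proj
    locally_trivial := fun b => by
      obtain ⟨U, n, φ, hU, hb, hφ, h1, h2⟩ := E.exists_local_complexFrame J hJ hc b
      refine ⟨U, n, fun x =>
        { φ x with
          map_smul' := fun c v => ?_ }, hU, hb, h1, h2⟩
      have h := complexModule_smul (J x) (hJ x) c v
      refine (congrArg (φ x) h).trans ?_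
      rw [map_add, map_smul, map_smul, hφ]
      change _ = c • φ x v
      conv_rhs => rw [← Complex.re_add_im c]
      rw [add_smul, mul_smul, Complex.coe_smul, Complex.coe_smul] }

end VBundle

/-! ### The Real bundle over a Clifford module bundle -/

namespace ModuleBundle

variable {X : FreeRealSpace.{u}} (F : ModuleBundle X.cliffordBundle)

/-- The action of the class `[z, 1]` on the fibre over `y`, for `z` in the orbit `y`. -/
noncomputable def lineAction (y : X.Quot) (z : X.Orbit y) : F.Fiber y →ₗ[ℝ] F.Fiber y :=
  F.action y (X.cliffordι y (X.lineEquiv y z 1))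

theorem lineAction_lineAction (y : X.Quot) (z : X.Orbit y) (v : F.Fiber y) :
    F.lineAction y z (F.lineAction y z v) = -v := by
  have h : X.cliffordι y (X.lineEquiv y z 1) * X.cliffordι y (X.lineEquiv y z 1) = -1 := by
    refine (CliffordAlgebra.ι_sq_scalar _ _).trans ?_
    have h1 : (-(X.lineMetric y)) (X.lineEquiv y z 1) = -1 :=
      congrArg Neg.neg ((X.lineMetric_lineEquiv y z 1).trans (one_mul 1))
    rw [h1, map_neg, map_one]
    rfl
  have h2 := congrArg (fun a => F.action y a v) h
  refine Eq.trans ?_ (h2.trans ?_)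
  · rw [map_mul]
    rfl
  · rw [map_neg, map_one]
    rfl

/-- Since `[inv x, 1] = -[x, 1]`, the two points of an orbit induce opposite complex structures on
the same fibre of `F`. This is the source of the conjugate-linearity of the Real structure. -/
theorem lineAction_fiberCast {y y' : X.Quot} (h : y = y') (z : X.Orbit y) (z' : X.Orbit y')
    (hz : z'.1 = X.inv z.1) (v : F.Fiber y) :
    F.fiberCast h (F.lineAction y z v) = -F.lineAction y' z' (F.fiberCast h v) := by
  subst h
  obtain rfl : z' = X.flip z := Subtype.ext hz
  have h1 : X.lineEquiv y (X.flip z) 1 = -X.lineEquiv y z 1 := by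
    rw [X.lineEquiv_flip, map_neg]
  have h2 : X.cliffordι y (X.lineEquiv y (X.flip z) 1) = -X.cliffordι y (X.lineEquiv y z 1) :=
    (congrArg (X.cliffordι y) h1).trans (map_neg _ _)
  change F.action y _ v = -(F.action y (X.cliffordι y (X.lineEquiv y (X.flip z) 1)) v)
  rw [h2, map_neg, LinearMap.neg_apply, neg_neg]

/-- The section `x ↦ [x, 1]` of the pulled-back Clifford bundle is continuous, being the constant
section `i` of the trivial bundle with fibre `ℂ`. -/
theorem continuous_lineAction :
    Continuous fun p : (F.toVBundle.pullback X.proj).Total =>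
      (⟨p.proj, F.lineAction (X.proj p.proj) ⟨p.proj, rfl⟩ p.snd⟩ :
        (F.toVBundle.pullback X.proj).Total) := by
  refine (continuous_pullback_iff X.proj F.Fiber _).2
    ⟨(F.toVBundle.pullback X.proj).continuous_proj, ?_⟩
  have h : Continuous fun p : (F.toVBundle.pullback X.proj).Total =>
      (⟨X.proj p.proj, (X.cliffordι _ (X.lineClass p.proj 1), p.snd)⟩ :
        TotalSpace (Unit × Unit) (X.cliffordBundle.Fiber ×ᵇ F.Fiber)) := by
    rw [(FiberBundle.Prod.isInducing_diag Unit X.cliffordBundle.Fiber Unit F.Fiber).continuous_iff]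
    refine Continuous.prodMk ?_ (F.continuous_pullbackMap X.proj)
    refine (X.isInducing_complexEquiv.continuous.snd.comp
      ((F.toVBundle.pullback X.proj).continuous_proj.prodMk
        (continuous_const (y := Complex.I)))).congr fun p => ?_
    exact TotalSpace.mk_inj.2 (X.complexEquiv_I p.proj)
  exact F.continuous_action.comp h

/-- The complex vector bundle underlying the Real bundle over `F`. -/
noncomputable def liftVBundle : VBundle ℂ X.carrier :=
  (F.toVBundle.pullback X.proj).ofComplexStructure
    (fun x => F.lineAction (X.proj x) ⟨x, rfl⟩)
    (fun x => F.lineAction_lineAction (X.proj x) ⟨x, rfl⟩) F.continuous_lineAction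

/-- The identity, from the fibres of the complex vector bundle to those of `F`. -/
noncomputable def ofLift (x : X.carrier) : F.liftVBundle.Fiber x ≃+ F.Fiber (X.proj x) :=
  AddEquiv.refl _

theorem ofLift_smul (x : X.carrier) (c : ℂ) (v : F.liftVBundle.Fiber x) :
    F.ofLift x (c • v) = c.re • F.ofLift x v +
      c.im • F.lineAction (X.proj x) ⟨x, rfl⟩ (F.ofLift x v) :=
  VBundle.complexModule_smul (F.lineAction (X.proj x) ⟨x, rfl⟩)
    (F.lineAction_lineAction (X.proj x) ⟨x, rfl⟩) c v

theorem continuous_ofLift_iff {Z : Type*} [TopologicalSpace Z] {g : Z → F.liftVBundle.Total} :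
    Continuous g ↔ Continuous (fun z => (g z).proj) ∧
      Continuous fun z => (⟨X.proj (g z).proj, F.ofLift _ (g z).snd⟩ : F.Total) :=
  continuous_pullback_iff X.proj F.Fiber g

theorem ofLift_ext {p p' : F.liftVBundle.Total} (h : p.proj = p'.proj)
    (h' : (⟨X.proj p.proj, F.ofLift _ p.snd⟩ : F.Total) =
      ⟨X.proj p'.proj, F.ofLift _ p'.snd⟩) : p = p' :=
  pullback_ext X.proj F.Fiber h h'

/-- The Real bundle on `X` with quotient `F`. -/
noncomputable def lift : RealBundle X.toRealSpace where
  toVBundle := F.liftVBundle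
  conj x :=
    { toFun := fun v => (F.ofLift (X.inv x)).symm (F.fiberCast (X.proj_inv x).symm (F.ofLift x v))
      map_add' := fun v w => by simp
      -- Transport preserves the real part of the scalar action and reverses the sign of the part
      -- given by `[x, 1]`, so `c` becomes its conjugate.
      map_smul' := fun c v => (F.ofLift (X.inv x)).injective (by
        rw [AddEquiv.apply_symm_apply, F.ofLift_smul, F.ofLift_smul, AddEquiv.apply_symm_apply,
          map_add, map_smul, map_smul,
          F.lineAction_fiberCast (X.proj_inv x).symm ⟨x, rfl⟩ ⟨X.inv x, rfl⟩ rfl]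
        simp) }
  continuous_conj := by
    have h := F.continuous_ofLift_iff.1 (continuous_id (X := F.liftVBundle.Total))
    refine F.continuous_ofLift_iff.2 ⟨X.continuous_inv.comp h.1, h.2.congr fun p => ?_⟩
    exact (F.mk_fiberCast (X.proj_inv p.proj).symm _).symm
  conj_conj p :=
    F.ofLift_ext (X.inv_inv p.proj) ((F.mk_fiberCast (X.proj_inv _).symm _).trans
      (F.mk_fiberCast (X.proj_inv p.proj).symm _))

theorem isCliffordQuotient_lift : IsCliffordQuotient F.lift F := by
  have h := F.continuous_ofLift_iff.1 (continuous_id (X := F.liftVBundle.Total))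
  refine ⟨fun x =>
    { toFun := F.ofLift x
      map_add' := map_add _
      map_smul' := fun r v => by
        refine (F.ofLift_smul x r v).trans ?_
        simp }, h.2, fun x => (F.ofLift x).bijective,
      fun x v => F.mk_fiberCast (X.proj_inv x).symm _, fun x v => ?_⟩
  refine (F.ofLift_smul x Complex.I v).trans ?_
  simp [lineAction]
  rfl

end ModuleBundle

/-! ### The zero bundle -/

theorem VBundle.continuous_zero {𝕜 : Type} [RCLike 𝕜] {B : Type u} [TopologicalSpace B]
    (E : VBundle 𝕜 B) : Continuous fun b => (⟨b, 0⟩ : E.Total) := by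
  refine continuous_of_cover continuous_id fun b => ?_
  obtain ⟨U, n, φ, hU, hb, h1, h2⟩ := E.locally_trivial b
  refine ⟨U, hU, hb, (h2.comp (continuous_id.prodMk (continuous_const (y := 0)))).congr fun x => ?_⟩
  · exact TotalSpace.mk_inj.2 (map_zero (φ x).symm)

/-- The zero Real bundle. -/
def RealBundle.zero (X : RealSpace.{u}) : RealBundle X :=
  letI : TopologicalSpace (TotalSpace Unit fun _ : X.carrier => PUnit.{u + 1}) :=
    TopologicalSpace.induced (fun p => p.proj) inferInstance
  have hp : Continuous fun p : TotalSpace Unit fun _ : X.carrier => PUnit.{u + 1} => p.proj :=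
    continuous_induced_dom
  { Fiber := fun _ => PUnit
    continuous_proj := hp
    -- Rank `0`: the model `Fin 0 → ℂ` is a single point, so the zero map is an isomorphism.
    locally_trivial := fun _ => ⟨Set.univ, 0, fun _ => 0, isOpen_univ, trivial,
      continuous_const, continuous_induced_rng.2 (continuous_subtype_val.comp continuous_fst)⟩
    conj := fun _ => 0
    continuous_conj := continuous_induced_rng.2 (X.continuous_inv.comp hp)
    conj_conj := fun ⟨x, _⟩ => TotalSpace.ext (X.inv_inv x) (Subsingleton.helim (by rfl) _ _) }

instance {X : RealSpace.{u}} (x : X.carrier) : Subsingleton ((RealBundle.zero X).Fiber x) :=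
  inferInstanceAs (Subsingleton PUnit)

/-- The relations of the Grothendieck group speak of direct sums only; adding a zero bundle brings
isomorphisms under them. -/
theorem RealBundle.isSum_zero {X : RealSpace.{u}} (E : RealBundle X) :
    E.IsSum E (RealBundle.zero X) := by
  have h0 : Continuous fun p : (RealBundle.zero X).Total => p.proj :=
    (RealBundle.zero X).continuous_proj
  let i : E.Hom E := ⟨⟨fun _ => LinearMap.id, continuous_id⟩, fun _ _ => rfl⟩
  refine ⟨i, ⟨⟨fun _ => 0, E.continuous_zero.comp h0⟩, fun x v => (map_zero (E.conj x)).symm⟩, i,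
    ⟨⟨fun _ => 0, (RealBundle.zero X).continuous_zero.comp E.continuous_proj⟩,
      fun x v => Subsingleton.elim _ _⟩, fun x v => rfl, fun x v => Subsingleton.elim _ _,
    fun x v => add_zero v⟩

/-! ### Grothendieck groups -/

namespace GrothendieckGroup

variable {Obj Obj' : Type*} {IsSum : Obj → Obj → Obj → Prop} {IsSum' : Obj' → Obj' → Obj' → Prop}

theorem cls_eq_add {E E₁ E₂ : Obj} (h : IsSum E E₁ E₂) :
    cls IsSum E = cls IsSum E₁ + cls IsSum E₂ :=
  QuotientAddGroup.eq_iff_sub_mem.2 (AddSubgroup.subset_closure ⟨E, E₁, E₂, h, rfl⟩)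

/-- From `Z = Z ⊕ Z` follows `[Z] = 0`, so no separate notion of zero object or isomorphism is
needed. -/
theorem cls_eq_of_isSum {E E' Z : Obj} (h : IsSum E E' Z) (hZ : IsSum Z Z Z) :
    cls IsSum E = cls IsSum E' := by
  have h0 : cls IsSum Z = 0 := left_eq_add.1 (cls_eq_add hZ)
  rw [cls_eq_add h, h0, add_zero]

theorem map_cls (T : Obj → Obj')
    (hT : ∀ E E₁ E₂, IsSum E E₁ E₂ → IsSum' (T E) (T E₁) (T E₂)) (E : Obj) :
    map T hT (cls IsSum E) = cls IsSum' (T E) :=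
  congrArg QuotientAddGroup.mk (FreeAbelianGroup.map_of_apply E)

theorem hom_ext {A : Type*} [AddCommGroup A] {f g : GrothendieckGroup Obj IsSum →+ A}
    (h : ∀ E, f (cls IsSum E) = g (cls IsSum E)) : f = g :=
  QuotientAddGroup.addMonoidHom_ext _ (FreeAbelianGroup.lift_ext _ _ h)

end GrothendieckGroup

open GrothendieckGroup

/-! ### The isomorphism of `K`-groups and its naturality -/

section

variable {X : FreeRealSpace.{u}}

/-- Applied to `E = E ⊕ 0` with `F` as quotient of the sum and `F'` as quotient of the summand,
descent gives `F = F' ⊕ Z` with `Z` the quotient of the zero bundle, and `Z = Z ⊕ Z` in the same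
way. -/
theorem IsCliffordQuotient.cls_eq {E : RealBundle X.toRealSpace}
    {F F' : ModuleBundle X.cliffordBundle} (h : IsCliffordQuotient E F)
    (h' : IsCliffordQuotient E F') :
    cls ModuleBundle.IsSum F = cls ModuleBundle.IsSum F' :=
  have hZ := (RealBundle.zero X.toRealSpace).isCliffordQuotient_quotient
  cls_eq_of_isSum (h.isSum h' hZ E.isSum_zero) (hZ.isSum hZ hZ (RealBundle.isSum_zero _))

/-- Descending `E = E ⊕ 0` gives `F = F ⊕ Z`; lifting this back with `E'` over the summand `F` gives
`E = E' ⊕ 0`. -/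
theorem IsCliffordQuotient.cls_eq_lift {E E' : RealBundle X.toRealSpace}
    {F : ModuleBundle X.cliffordBundle} (h : IsCliffordQuotient E F)
    (h' : IsCliffordQuotient E' F) :
    cls RealBundle.IsSum E = cls RealBundle.IsSum E' :=
  have hZ := (RealBundle.zero X.toRealSpace).isCliffordQuotient_quotient
  cls_eq_of_isSum (h.isSum_lift h' hZ (h.isSum h hZ E.isSum_zero)) (RealBundle.isSum_zero _)

variable (X)

/-- The homomorphism `KR(X) → K^{C⁻(L)}(Y)` induced by `E ↦ E / (ℤ/2)`. -/
noncomputable def KR.toTwistedK : KR X.toRealSpace →+ TwistedK X.cliffordBundle :=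
  map RealBundle.quotient fun E E₁ E₂ h => E.isCliffordQuotient_quotient.isSum
    E₁.isCliffordQuotient_quotient E₂.isCliffordQuotient_quotient h

/-- The homomorphism `K^{C⁻(L)}(Y) → KR(X)` induced by the pullback along `X → Y`. -/
noncomputable def TwistedK.toKR : TwistedK X.cliffordBundle →+ KR X.toRealSpace :=
  map ModuleBundle.lift fun F F₁ F₂ h => F.isCliffordQuotient_lift.isSum_lift
    F₁.isCliffordQuotient_lift F₂.isCliffordQuotient_lift h

variable {X} in
theorem KR.toTwistedK_cls {E : RealBundle X.toRealSpace} {F : ModuleBundle X.cliffordBundle}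
    (h : IsCliffordQuotient E F) :
    KR.toTwistedK X (cls RealBundle.IsSum E) = cls ModuleBundle.IsSum F := by
  rw [KR.toTwistedK, map_cls]
  exact E.isCliffordQuotient_quotient.cls_eq h

variable {X} in
theorem TwistedK.toKR_cls {E : RealBundle X.toRealSpace} {F : ModuleBundle X.cliffordBundle}
    (h : IsCliffordQuotient E F) :
    TwistedK.toKR X (cls ModuleBundle.IsSum F) = cls RealBundle.IsSum E := by
  rw [TwistedK.toKR, map_cls]
  exact F.isCliffordQuotient_lift.cls_eq_lift h

/-- The isomorphism `KR(X) ≃ K^{C⁻(L)}(Y)` induced by `E ↦ E / (ℤ/2)`. -/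
noncomputable def KR.equivTwistedK : KR X.toRealSpace ≃+ TwistedK X.cliffordBundle :=
  (KR.toTwistedK X).toAddEquiv (TwistedK.toKR X)
    (hom_ext fun E => by
      rw [AddMonoidHom.comp_apply, KR.toTwistedK_cls E.isCliffordQuotient_quotient,
        TwistedK.toKR_cls E.isCliffordQuotient_quotient]
      rfl)
    (hom_ext fun F => by
      rw [AddMonoidHom.comp_apply, TwistedK.toKR_cls F.isCliffordQuotient_lift,
        KR.toTwistedK_cls F.isCliffordQuotient_lift]
      rfl)

variable {X}

theorem KR.equivTwistedK_cls {E : RealBundle X.toRealSpace} {F : ModuleBundle X.cliffordBundle}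
    (h : IsCliffordQuotient E F) :
    KR.equivTwistedK X (cls RealBundle.IsSum E) = cls ModuleBundle.IsSum F :=
  KR.toTwistedK_cls h

/-- It suffices to compare classes of bundles. The pullback of `E/G` is a quotient of the pullback
of `E`, and the class of a quotient does not depend on which quotient is taken. -/
theorem KR.equivTwistedK_pullback {X' : FreeRealSpace.{u}}
    (f : X'.toRealSpace.Hom X.toRealSpace) (a : KR X.toRealSpace) :
    KR.equivTwistedK X' (KR.pullback f a) =
      TwistedK.pullback (FreeRealSpace.cliffordMap f) (KR.equivTwistedK X a) := by
  have h : (KR.equivTwistedK X').toAddMonoidHom.comp (KR.pullback f) =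
      (TwistedK.pullback (FreeRealSpace.cliffordMap f)).comp
        (KR.equivTwistedK X).toAddMonoidHom := hom_ext fun E => by
    have hE := E.isCliffordQuotient_quotient
    have h1 : KR.pullback f (cls RealBundle.IsSum E) = cls RealBundle.IsSum (E.pullback f) :=
      map_cls _ _ E
    have h2 : TwistedK.pullback (FreeRealSpace.cliffordMap f)
        (cls ModuleBundle.IsSum E.quotient) =
        cls ModuleBundle.IsSum (E.quotient.pullback (FreeRealSpace.cliffordMap f)) :=
      map_cls _ _ E.quotient
    change KR.equivTwistedK X' (KR.pullback f (cls RealBundle.IsSum E)) =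
      TwistedK.pullback (FreeRealSpace.cliffordMap f) (KR.equivTwistedK X (cls RealBundle.IsSum E))
    rw [h1, KR.equivTwistedK_cls hE, h2, KR.equivTwistedK_cls (hE.pullback f)]
  exact DFunLike.congr_fun h a

end

end RealKTheory

/-- There are isomorphisms `Φ_X : KR(X) ≃ K^{C⁻(L)}(Y)` for all compact Hausdorff spaces `X` with a
free `ℤ/2`-action, natural in `X` with respect to equivariant maps and induced by `E ↦ E/(ℤ/2)`. -/
theorem theorem4p1 :
    ∃ Φ : ∀ X : RealKTheory.FreeRealSpace.{u},
        RealKTheory.KR X.toRealSpace ≃+ RealKTheory.TwistedK X.cliffordBundle,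
      (∀ (X' X : RealKTheory.FreeRealSpace.{u}) (f : X'.toRealSpace.Hom X.toRealSpace)
          (a : RealKTheory.KR X.toRealSpace),
        Φ X' (RealKTheory.KR.pullback f a) =
          RealKTheory.TwistedK.pullback (RealKTheory.FreeRealSpace.cliffordMap f) (Φ X a)) ∧
      ∀ (X : RealKTheory.FreeRealSpace.{u}) (E : RealKTheory.RealBundle X.toRealSpace),
        (∃ F : RealKTheory.ModuleBundle X.cliffordBundle, RealKTheory.IsCliffordQuotient E F) ∧
        ∀ F : RealKTheory.ModuleBundle X.cliffordBundle, RealKTheory.IsCliffordQuotient E F →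
          Φ X (RealKTheory.GrothendieckGroup.cls RealKTheory.RealBundle.IsSum E) =
            RealKTheory.GrothendieckGroup.cls RealKTheory.ModuleBundle.IsSum F := by
  exact ⟨RealKTheory.KR.equivTwistedK, fun X' X f a => RealKTheory.KR.equivTwistedK_pullback f a,
    fun X E => ⟨⟨E.quotient, E.isCliffordQuotient_quotient⟩,
      fun F h => RealKTheory.KR.equivTwistedK_cls h⟩⟩
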